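/- Let $\mathbb F$ be a field and let $n,k,\delta$ be integers with $1\le k<n$ and $\delta\ge 0$. An $(n,k,\delta)$ convolutional code over $\mathbb F$ is a free $\mathbb F[z]$-submodule $\mathfrak C$ of $\mathbb F[z]^n$ of rank $k$ whose degree, i.e. the maximal degree of the $k\times k$ minors of a generator matrix $G(z)\in\mathbb F[z]^{n\times k}$ (a matrix whose columns form a basis of $\mathfrak C$), equals $\delta$. The code is non-catastrophic if $G(x)$ has rank $k$ for every $x$ in the algebraic closure of $\mathbb F$. For $v(z)=\sum_t v_tz^t\in\mathbb F[z]^n$ let $wt(v_t)$ be the number of nonzero components of $v_t\in\mathbb F^n$. The $j$-th column distance of $\mathfrak C$ is $$d_j^c(\mathfrak C)=\min\Big\{\sum_{t=0}^{j}wt(v_t)\ \Big|\ v(z)\in\mathfrak C,\ v_0\neq 0\Big\}.$$ Set $L=\lfloor\delta/k\rfloor+\lfloor\delta/(n-k)\rfloor$. An $(n,k,\delta)$ convolutional code $\mathfrak C$ is MDP (has maximum distance profile) if $d_j^c(\mathfrak C)=(n-k)(j+1)+1$ for all $j=0,\dots,L$. Put \begin{align*} M_1&:=(L+1)(n-k)\binom{(L+1)n}{(L+1)(n-k)},\\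 M_2&:=(L+1)(n-k)\prod_{s=0}^{L}\binom{n+sk}{n-k},\\ M_3&:=(L+1)(n-k)\sum_{i=n-k}^{n}\binom{i-1}{n-k-1}\prod_{s=0}^{L-1}\binom{2n+sk-i}{n-k}. \end{align*} Theorem. If $|\mathbb F|>\min\{M_1,M_2,M_3\}$ (in particular if $\mathbb F$ is infinite), then there exists an $(n,k,\delta)$ MDP convolutional code over $\mathbb F$, and it can be chosen to be non-catastrophic. -/

import Mathlib

open Polynomial

noncomputable section

namespace ConvCode

variable {F : Type*} [Field F] {n k : ℕ}

/-- `G` is a generator matrix of `C ⊆ F[z]^n`: it has full column rank and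
`C = {G(z) m(z) : m(z) ∈ F[z]^k}`. -/
def IsGeneratorMatrix (G : Matrix (Fin n) (Fin k) F[X])
    (C : Submodule F[X] (Fin n → F[X])) : Prop :=
  LinearIndependent F[X] G.col ∧ C = LinearMap.range G.mulVecLin

/-- The maximal degree of the `k × k` minors of `G`. (If `G` has full column rank then some minor
is nonzero, so counting zero minors with degree `0` does not change the maximum.) -/
def minorDegree (G : Matrix (Fin n) (Fin k) F[X]) : ℕ :=
  Finset.univ.sup fun e : Fin k ↪o Fin n => (G.submatrix e id).det.natDegree

/-- `C` is an `(n, k, δ)` convolutional code: a free submodule of `F[z]^n` of rank `k` whose degree,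
the maximal degree of the `k × k` minors of a generator matrix, is `δ`. (Generator matrices are
unique up to unimodular column operations, so the choice of the generator matrix is irrelevant.) -/
structure IsConvolutionalCode (k δ : ℕ) (C : Submodule F[X] (Fin n → F[X])) : Prop where
  free : Module.Free F[X] C
  rank_eq : Module.finrank F[X] C = k
  degree_eq : ∃ G : Matrix (Fin n) (Fin k) F[X], IsGeneratorMatrix G C ∧ minorDegree G = δ

/-- `G(x)` has full column rank for every `x` in the algebraic closure of `F`. -/
def IsRightPrime (G : Matrix (Fin n) (Fin k) F[X]) : Prop :=
  ∀ x : AlgebraicClosure F, (G.map fun p => aeval x p).rank = k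

/-- One (equivalently, each) generator matrix of the rank `k` code `C` is right prime. -/
def IsNoncatastrophic (k : ℕ) (C : Submodule F[X] (Fin n → F[X])) : Prop :=
  ∃ G : Matrix (Fin n) (Fin k) F[X], IsGeneratorMatrix G C ∧ IsRightPrime G

/-- The coefficient vector `v_t ∈ F^n` of `v(z) = ∑ v_t z^t`. -/
def coeffVec (v : Fin n → F[X]) (t : ℕ) : Fin n → F := fun i => (v i).coeff t

open scoped Classical in
/-- The weight `∑_{t=0}^{j} wt(v_t)` of the truncation of `v(z)` at time `j`. -/
def truncWeight (v : Fin n → F[X]) (j : ℕ) : ℕ :=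
  ∑ t ∈ Finset.range (j + 1), hammingNorm (coeffVec v t)

/-- The `j`-th column distance `min {∑_{t=0}^{j} wt(v_t) | v(z) ∈ C, v_0 ≠ 0}`. (A value different
from `0` can only occur if the set is nonempty, and is then its minimum.) -/
def columnDistance (C : Submodule F[X] (Fin n → F[X])) (j : ℕ) : ℕ :=
  sInf {w | ∃ v ∈ C, coeffVec v 0 ≠ 0 ∧ truncWeight v j = w}

/-- `L = ⌊δ/k⌋ + ⌊δ/(n-k)⌋`. -/
def L (n k δ : ℕ) : ℕ := δ / k + δ / (n - k)

/-- Maximum distance profile: `d_j^c(C) = (n-k)(j+1) + 1` for `j = 0, …, L`. -/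
def IsMDP (k δ : ℕ) (C : Submodule F[X] (Fin n → F[X])) : Prop :=
  ∀ j ≤ L n k δ, columnDistance C j = (n - k) * (j + 1) + 1

/-- `(L+1)(n-k) · C((L+1)n, (L+1)(n-k))`. -/
def M₁ (n k δ : ℕ) : ℕ :=
  (L n k δ + 1) * (n - k) * ((L n k δ + 1) * n).choose ((L n k δ + 1) * (n - k))

/-- `(L+1)(n-k) · C(n, n-k) C(n+k, n-k) ⋯ C(n+Lk, n-k)`. -/
def M₂ (n k δ : ℕ) : ℕ :=
  (L n k δ + 1) * (n - k) *
    ∏ s ∈ Finset.range (L n k δ + 1), (n + s * k).choose (n - k)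

/-- `(L+1)(n-k) · ∑_{i=n-k}^{n} C(i-1, n-k-1) C(2n-i, n-k) ⋯ C(2n+(L-1)k-i, n-k)`,
with `L` factors after the first one. -/
def M₃ (n k δ : ℕ) : ℕ :=
  (L n k δ + 1) * (n - k) *
    ∑ i ∈ Finset.Icc (n - k) n, (i - 1).choose (n - k - 1) *
      ∏ s ∈ Finset.range (L n k δ), (2 * n + s * k - i).choose (n - k)

end ConvCode

end

open Polynomial

noncomputable section

namespace ConvCode

/-! Write r = n - k. List the coefficients of a codeword as one sequence w, in each block the k
inputs before the r outputs, and require that up to time L every output x satisfy w x = ∑ s (x - y)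
w y over the inputs y < x, for a single scalar sequence s. A full size minor of the sliding parity
check matrix, with column set E, is then up to sign a minor of the Toeplitz matrix of s: its columns
are the inputs in E, its rows the outputs outside E. If every such minor that is not trivially zero
is nonzero, the code is MDP (`lt_card_support`, `columnDistance_eq`).

Each of these minors is a nonzero polynomial in the entries of s: under s_m = X^(m^2) the identity
permutation gives the unique term of least degree, by the rearrangement inequality
(`det_lowerToeplitz_X_pow_ne_zero`). Their product has degree at most (number of sets E) * (L+1)r,
so a larger field contains a suitable s. Bounding the number of sets E in three ways gives M₁, M₂,
M₃.

It remains to realize s by a non-catastrophic code of degree exactly δ. For this a Hankel matrix of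
the blocks p_l of s, with balanced column degrees d and row degrees e that both sum to δ, must be
invertible. It is a minor of the same Toeplitz matrix, and it takes the place of the empty minor in
the count, so the bound does not grow (`exists_isRegular_family`). Invertibility yields a
denominator A (`exists_isDenominator`); reversing its columns gives a generator matrix that
satisfies the relations above up to degree min (d_j + e_i) ≥ L. A vector killed by this matrix at x
≠ 0 would, after division by z - 1/x, give a kernel vector of the Hankel matrix. The same argument
with 0 in place of 1/x shows that the matrix is column reduced, so its degree is ∑ d_j = δ. -/

/-! ### Generic nonvanishing of Toeplitz minors -/

/-- The entry at `(x, y)` of the strictly lower triangular Toeplitz matrix with symbol `s`. -/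
def lowerToeplitz {R : Type*} [Zero R] (s : ℕ → R) (x y : ℕ) : R :=
  if y < x then s (x - y) else 0

lemma lowerToeplitz_map {R S : Type*} [Semiring R] [Semiring S] (f : R →+* S) (s : ℕ → R)
    (x y : ℕ) : f (lowerToeplitz s x y) = lowerToeplitz (fun m => f (s m)) x y := by
  unfold lowerToeplitz; split_ifs <;> simp

lemma perm_eq_one_of_strictMono {w : ℕ} (σ : Equiv.Perm (Fin w)) (h : Monotone σ) : σ = 1 := by
  have hs : StrictMono σ := h.strictMono_of_injective σ.injective
  have := Subsingleton.elim (hs.orderIsoOfSurjective σ σ.surjective) (OrderIso.refl (Fin w))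
  ext i
  have := congrArg (fun e : Fin w ≃o Fin w => e i) this
  simpa using congrArg Fin.val this

/-- After expanding the squares only the cross terms depend on σ, so this is the strict
rearrangement inequality; equality would force σ to be monotone. The hypotheses y < z make the
natural subtractions exact. -/
lemma sum_sq_sub_lt {w : ℕ} (z y : Fin w → ℕ) (hz : StrictMono z) (hy : StrictMono y)
    (σ : Equiv.Perm (Fin w)) (hσ : σ ≠ 1) (h1 : ∀ i, y i < z i) (h2 : ∀ i, y i < z (σ i)) :
    ∑ i, (z i - y i) ^ 2 < ∑ i, (z (σ i) - y i) ^ 2 := by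
  have hmono : Monovary (fun i => (z i : ℤ)) (fun i => (y i : ℤ)) := by
    intro i j hij
    have : i < j := hy.lt_iff_lt.mp (Nat.cast_lt.mp hij)
    exact Nat.cast_le.mpr (hz this).le
  have key : ∑ i, (z (σ i) : ℤ) * y i < ∑ i, (z i : ℤ) * y i := by
    have := hmono.sum_comp_perm_mul_lt_sum_mul_iff (σ := σ)
    refine this.2 fun hm => hσ (perm_eq_one_of_strictMono σ fun i j hij => ?_)
    rcases hij.eq_or_lt with rfl | hij
    · exact le_rfl
    have := hm (i := i) (j := j) (Nat.cast_lt.mpr (hy hij))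
    simp only [Function.comp] at this
    exact hz.le_iff_le.mp (by exact_mod_cast this)
  have e2 : ∑ i, (z (σ i) : ℤ) ^ 2 = ∑ i, (z i : ℤ) ^ 2 :=
    Equiv.sum_comp σ (fun i => (z i : ℤ) ^ 2)
  have expand : ∀ f : Fin w → ℕ, (∀ i, y i < f i) → ((∑ i, (f i - y i) ^ 2 : ℕ) : ℤ) =
      ∑ i, (f i : ℤ) ^ 2 + ∑ i, (y i : ℤ) ^ 2 - 2 * ∑ i, (f i : ℤ) * y i := by
    intro f hf
    rw [Finset.mul_sum, ← Finset.sum_add_distrib, ← Finset.sum_sub_distrib]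
    push_cast
    refine Finset.sum_congr rfl fun i _ => ?_
    rw [Nat.cast_sub (hf i).le]
    ring
  have e1 := expand z h1
  have e3 := expand (fun i => z (σ i)) h2
  zify at *
  linarith

/-- By `sum_sq_sub_lt` every other nonzero term of the expansion has a larger exponent than the
identity term, so the coefficient at that exponent is 1. -/
lemma det_lowerToeplitz_X_pow_ne_zero {F : Type*} [Field F] {w : ℕ} (z y : Fin w → ℕ)
    (hz : StrictMono z) (hy : StrictMono y) (h : ∀ i, y i < z i) :
    (Matrix.of fun i j => lowerToeplitz (fun m => (X : F[X]) ^ (m ^ 2)) (z i) (y j)).det ≠ 0 := by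
  intro h0
  have hc := congrArg (fun p => p.coeff (∑ i, (z i - y i) ^ 2)) h0
  simp only [Matrix.det_apply, finsetSum_coeff, coeff_zero] at hc
  rw [Finset.sum_eq_single 1] at hc
  · simp [lowerToeplitz, h, Finset.prod_pow_eq_pow_sum] at hc
  · intro σ _ hσ
    by_cases hall : ∀ i, y i < z (σ i)
    · have hlt := sum_sq_sub_lt z y hz hy σ hσ h hall
      have : ∏ i, (Matrix.of fun i j => lowerToeplitz (fun m => (X : F[X]) ^ (m ^ 2)) (z i) (y j))
          (σ i) i = X ^ ∑ i, (z (σ i) - y i) ^ 2 := by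
        rw [← Finset.prod_pow_eq_pow_sum]
        exact Finset.prod_congr rfl fun i _ => by simp [lowerToeplitz, hall i]
      rw [this, Units.smul_def, zsmul_eq_mul, ← C_eq_intCast, coeff_C_mul, coeff_X_pow,
        if_neg hlt.ne, mul_zero]
    · push Not at hall
      obtain ⟨i, hi⟩ := hall
      rw [Finset.prod_eq_zero (Finset.mem_univ i)]
      · simp
      · simp [lowerToeplitz, not_lt.mpr hi]
  · simp

lemma totalDegree_det_le {R σ : Type*} [CommRing R] {w : ℕ}
    (A : Matrix (Fin w) (Fin w) (MvPolynomial σ R)) (h : ∀ i j, (A i j).totalDegree ≤ 1) :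
    A.det.totalDegree ≤ w := by
  rw [Matrix.det_apply]
  refine MvPolynomial.totalDegree_finsetSum_le fun τ _ => ?_
  rw [Units.smul_def, zsmul_eq_mul]
  refine (MvPolynomial.totalDegree_mul _ _).trans ?_
  have h1 : ((((Equiv.Perm.sign τ : ℤˣ) : ℤ) : MvPolynomial σ R)).totalDegree = 0 := by
    rw [← map_intCast (MvPolynomial.C (σ := σ) (R := R))]
    exact MvPolynomial.totalDegree_C _
  rw [h1, zero_add]
  refine (MvPolynomial.totalDegree_finsetProd _ _).trans ?_
  refine (Finset.sum_le_sum fun i _ => h _ _).trans ?_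
  simp

/-- Nonvanishing of finitely many nontrivial minors of a lower triangular Toeplitz matrix over a
large field. -/
lemma exists_lowerToeplitz_det_ne_zero {F ι : Type*} [Field F] (A : Finset ι) (w : ι → ℕ)
    (z y : ∀ a, Fin (w a) → ℕ) (hz : ∀ a ∈ A, StrictMono (z a)) (hy : ∀ a ∈ A, StrictMono (y a))
    (h : ∀ a ∈ A, ∀ i, y a i < z a i) (B : ℕ) (hB : ∀ a ∈ A, w a ≤ B)
    (hF : ((A.card * B : ℕ) : ℕ∞) < ENat.card F) :
    ∃ s : ℕ → F, ∀ a ∈ A,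
      (Matrix.of fun i j => lowerToeplitz s (z a i) (y a j)).det ≠ 0 := by
  classical
  obtain ⟨T, hT⟩ : ∃ T : Finset F, A.card * B < T.card := by
    cases finite_or_infinite F
    · have := Fintype.ofFinite F
      refine ⟨Finset.univ, ?_⟩
      rw [ENat.card_eq_coe_fintype_card] at hF
      exact_mod_cast hF
    · obtain ⟨T, hT⟩ := Infinite.exists_subset_card_eq F (A.card * B + 1)
      exact ⟨T, by omega⟩
  -- All differences z - y that occur are below N, so finitely many variables suffice and the value
  -- of `v` beyond N does not matter.
  obtain ⟨N, hN⟩ : ∃ N : ℕ, ∀ a ∈ A, ∀ i, z a i < N := by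
    refine ⟨(A.sup fun a => Finset.univ.sup (z a)) + 1, fun a ha i => Nat.lt_succ_of_le ?_⟩
    exact (Finset.le_sup (f := z a) (Finset.mem_univ i)).trans
      (Finset.le_sup (f := fun a => Finset.univ.sup (z a)) ha)
  let v : ℕ → MvPolynomial (Fin N) F := fun m => if hm : m < N then MvPolynomial.X ⟨m, hm⟩ else 0
  let D : ι → MvPolynomial (Fin N) F := fun a =>
    (Matrix.of fun i j => lowerToeplitz v (z a i) (y a j)).det
  have hD0 : ∀ a ∈ A, D a ≠ 0 := by
    intro a ha h0
    let φ : MvPolynomial (Fin N) F →ₐ[F] F[X] :=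
      MvPolynomial.aeval fun m => (X : F[X]) ^ ((m : ℕ) ^ 2)
    have h1 := congrArg φ h0
    rw [AlgHom.map_det, map_zero] at h1
    refine det_lowerToeplitz_X_pow_ne_zero (F := F) (z a) (y a) (hz a ha) (hy a ha) (h a ha) ?_
    rw [← h1]
    congr 1
    ext1 i j
    simp only [Matrix.of_apply, AlgHom.mapMatrix_apply, Matrix.map_apply, lowerToeplitz]
    split_ifs with hlt
    · have : z a i - y a j < N := lt_of_le_of_lt (Nat.sub_le _ _) (hN a ha i)
      simp [v, this, φ]
    · simp
  have hdeg : (∏ a ∈ A, D a).totalDegree ≤ A.card * B := by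
    refine (MvPolynomial.totalDegree_finsetProd _ _).trans ?_
    rw [← smul_eq_mul]
    refine Finset.sum_le_card_nsmul _ _ _ fun a ha => le_trans ?_ (hB a ha)
    refine totalDegree_det_le _ fun i j => ?_
    simp only [Matrix.of_apply, lowerToeplitz, v]
    split_ifs <;> simp
  have hne : ∏ a ∈ A, D a ≠ 0 := Finset.prod_ne_zero_iff.2 hD0
  obtain ⟨x, hx⟩ : ∃ x : Fin N → F, MvPolynomial.eval x (∏ a ∈ A, D a) ≠ 0 := by
    by_contra! hcon
    refine hne (MvPolynomial.eq_zero_of_eval_zero_at_prod_finset _ (fun _ => T) (fun i => ?_)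
      fun x _ => hcon x)
    exact ((MvPolynomial.degreeOf_le_totalDegree _ i).trans hdeg).trans_lt hT
  rw [map_prod] at hx
  refine ⟨fun m => MvPolynomial.eval x (v m), fun a ha => ?_⟩
  have := Finset.prod_ne_zero_iff.1 hx a ha
  rw [RingHom.map_det] at this
  convert this using 2
  ext1 i j
  simp only [Matrix.of_apply, RingHom.mapMatrix_apply, Matrix.map_apply]
  rw [lowerToeplitz_map]

/-! ### Counting the index sets of nontrivial minors -/

/-- The index sets of the full size minors of an `mr × m(k+r)` sliding parity check matrix that are
not trivially zero. -/
def columnSets (k r m : ℕ) : Finset (Finset ℕ) :=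
  ((Finset.range (m * (k + r))).powersetCard (m * r)).filter
    fun E => ∀ β ≤ m, β * r ≤ (E ∩ Finset.range (β * (k + r))).card

lemma mem_columnSets {k r m : ℕ} {E : Finset ℕ} :
    E ∈ columnSets k r m ↔ E ⊆ Finset.range (m * (k + r)) ∧ E.card = m * r ∧
      ∀ β ≤ m, β * r ≤ (E ∩ Finset.range (β * (k + r))).card := by
  simp [columnSets, Finset.mem_powersetCard, and_assoc]

lemma card_columnSets_le_choose (k r m : ℕ) :
    (columnSets k r m).card ≤ (m * (k + r)).choose (m * r) := by
  refine (Finset.card_filter_le _ _).trans ?_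
  simp

lemma exists_initial_segment (E : Finset ℕ) (c : ℕ) (hc : c ≤ E.card) :
    ∃ D ⊆ E, D.card = c ∧ ∀ x ∈ D, ∀ y ∈ E, y ∉ D → x < y := by
  induction c with
  | zero => exact ⟨∅, by simp, by simp, by simp⟩
  | succ c ih =>
    obtain ⟨D, hDE, hD, hlt⟩ := ih (by omega)
    have hne : (E \ D).Nonempty := by
      rw [← Finset.card_pos, Finset.card_sdiff_of_subset hDE]; omega
    have hmem := Finset.min'_mem _ hne
    rw [Finset.mem_sdiff] at hmem
    refine ⟨insert ((E \ D).min' hne) D, Finset.insert_subset hmem.1 hDE, ?_, ?_⟩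
    · rw [Finset.card_insert_of_notMem hmem.2, hD]
    · intro x hx y hy hyD
      rw [Finset.mem_insert, not_or] at hyD
      have hyED : y ∈ E \ D := Finset.mem_sdiff.2 ⟨hy, hyD.2⟩
      rcases Finset.mem_insert.1 hx with rfl | hx
      · exact lt_of_le_of_ne (Finset.min'_le _ _ hyED) (Ne.symm hyD.1)
      · exact hlt x hx y hy hyD.2

/-- The members of `columnSets k r m` that have `D` as an initial segment. -/
def columnSetsFrom (k r m : ℕ) (D : Finset ℕ) : Finset (Finset ℕ) :=
  (columnSets k r m).filter fun E => D ⊆ E ∧ ∀ x ∈ D, ∀ y ∈ E, y ∉ D → x < y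

/-- The elements are added r at a time. Once the first (m+1)r elements E' are known, the next r
avoid E' and everything up to i; as E' has exactly mr elements above i, (m+2)(k+r) - (i+1) - mr
places remain. -/
lemma card_columnSetsFrom_le {k r : ℕ} {D : Finset ℕ} {i : ℕ} (hr : 0 < r) (hD : D.card = r)
    (hiD : i ∈ D) (hDi : ∀ x ∈ D, x ≤ i) (hi : i < k + r) (m : ℕ) :
    (columnSetsFrom k r (m + 1) D).card ≤
      ∏ s ∈ Finset.range m, (2 * (k + r) + s * k - (i + 1)).choose r := by
  induction m with
  | zero =>
    have : columnSetsFrom k r 1 D ⊆ {D} := by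
      intro E hE
      simp only [columnSetsFrom, Finset.mem_filter, mem_columnSets] at hE
      rw [Finset.mem_singleton]
      exact (Finset.eq_of_subset_of_card_le hE.2.1 (by rw [hE.1.2.1, hD]; simp)).symm
    simpa using Finset.card_le_card this
  | succ m ih =>
    rw [Finset.prod_range_succ]
    have hsub : columnSetsFrom k r (m + 2) D ⊆ (columnSetsFrom k r (m + 1) D).biUnion fun E' =>
        (Finset.powersetCard r (Finset.range ((m + 2) * (k + r)) \
          (Finset.range (i + 1) ∪ E'))).image (E' ∪ ·) := by
      intro E hE
      simp only [columnSetsFrom, Finset.mem_filter, mem_columnSets] at hE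
      obtain ⟨⟨hEr, hEc, hEβ⟩, hDE, hDlt⟩ := hE
      obtain ⟨E', hE'E, hE'c, hE'lt⟩ := exists_initial_segment E ((m + 1) * r)
        (by rw [hEc]; exact Nat.mul_le_mul_right _ (by omega))
      have hDE' : D ⊆ E' := by
        intro x hx
        by_contra hxE'
        have : E' ⊆ D.erase x := by
          intro y hy
          have hyx := hE'lt y hy x (hDE hx) hxE'
          rw [Finset.mem_erase]
          refine ⟨hyx.ne, ?_⟩
          by_contra hyD
          have := hDlt x hx y (hE'E hy) hyD
          omega
        have := Finset.card_le_card this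
        rw [Finset.card_erase_of_mem hx, hD, hE'c, Nat.add_mul] at this
        omega
      simp only [Finset.mem_biUnion, Finset.mem_image, Finset.mem_powersetCard]
      refine ⟨E', ?_, E \ E', ⟨?_, ?_⟩, ?_⟩
      · simp only [columnSetsFrom, Finset.mem_filter, mem_columnSets]
        refine ⟨⟨?_, hE'c, ?_⟩, hDE', fun x hx y hy => hDlt x hx y (hE'E hy)⟩
        · intro x hx
          -- Otherwise the first m + 1 blocks would contain fewer than (m+1)r elements of E.
          by_contra hxr
          have : E ∩ Finset.range ((m + 1) * (k + r)) ⊆ E'.erase x := by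
            intro y hy
            rw [Finset.mem_inter, Finset.mem_range] at hy
            rw [Finset.mem_range] at hxr
            rw [Finset.mem_erase]
            refine ⟨by omega, ?_⟩
            by_contra hyE'
            have := hE'lt x hx y hy.1 hyE'
            omega
          have := Finset.card_le_card this
          rw [Finset.card_erase_of_mem hx, hE'c] at this
          have h2 := hEβ (m + 1) (by omega)
          have : 0 < (m + 1) * r := by positivity
          omega
        · intro β hβ
          -- Either E' keeps all of E in the first β blocks, or an element of E outside E' lies
          -- there and then all of E' precedes it.
          by_cases hs : E ∩ Finset.range (β * (k + r)) ⊆ E'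
          · refine (hEβ β (by omega)).trans (Finset.card_le_card ?_)
            exact Finset.subset_inter hs Finset.inter_subset_right
          · obtain ⟨y, hy, hyE'⟩ := Finset.not_subset.1 hs
            rw [Finset.mem_inter, Finset.mem_range] at hy
            rw [Finset.inter_eq_left.2, hE'c]
            · exact Nat.mul_le_mul_right _ hβ
            · intro x hx
              have := hE'lt x hx y hy.1 hyE'
              rw [Finset.mem_range]; omega
      · intro y hy
        rw [Finset.mem_sdiff] at hy
        rw [Finset.mem_sdiff, Finset.mem_union]
        refine ⟨hEr hy.1, ?_⟩
        rintro (h | h)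
        · rw [Finset.mem_range] at h
          have := hE'lt i (hDE' hiD) y hy.1 hy.2
          omega
        · exact hy.2 h
      · rw [Finset.card_sdiff_of_subset hE'E, hEc, hE'c, ← Nat.sub_mul]
        simp
      · exact Finset.union_sdiff_of_subset hE'E
    refine (Finset.card_le_card hsub).trans ?_
    refine (Finset.card_biUnion_le_card_mul _ _ ((2 * (k + r) + m * k - (i + 1)).choose r)
      fun E' hE' => ?_).trans (Nat.mul_le_mul_right _ ih)
    refine Finset.card_image_le.trans ?_
    rw [Finset.card_powersetCard]
    refine Nat.choose_le_choose _ ?_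
    simp only [columnSetsFrom, Finset.mem_filter, mem_columnSets] at hE'
    obtain ⟨⟨hEr, hEc, -⟩, hDE, hDlt⟩ := hE'
    have hun : Finset.range (i + 1) ∪ E' = Finset.range (i + 1) ∪ (E' \ D) := by
      ext x
      simp only [Finset.mem_union, Finset.mem_range, Finset.mem_sdiff]
      have := hDi x
      by_cases x ∈ D <;> simp_all
    have hdisj : Disjoint (Finset.range (i + 1)) (E' \ D) := by
      rw [Finset.disjoint_left]
      intro x hx hx'
      rw [Finset.mem_sdiff] at hx'
      have := hDlt i hiD x hx'.1 hx'.2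
      rw [Finset.mem_range] at hx
      omega
    have hcard : (Finset.range (i + 1) ∪ E').card = i + 1 + m * r := by
      rw [hun, Finset.card_union_of_disjoint hdisj, Finset.card_range,
        Finset.card_sdiff_of_subset hDE, hEc, hD, Nat.add_mul]
      omega
    rw [Finset.card_sdiff_of_subset, hcard, Finset.card_range]
    · have : (m + 2) * (k + r) = 2 * (k + r) + m * k + m * r := by ring
      omega
    · refine Finset.union_subset ?_ (hEr.trans ?_)
      · refine Finset.range_subset_range.2 ?_
        nlinarith [Nat.zero_le (m * (k + r))]
      · exact Finset.range_subset_range.2 (Nat.mul_le_mul_right _ (by omega))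

/-- Here i - 1 is the r-th smallest element of E. The condition for β = 1 puts it in the first
block, and the r - 1 smaller elements are chosen below it. -/
lemma card_columnSets_le_sum {k r : ℕ} (hr : 0 < r) (m : ℕ) :
    (columnSets k r (m + 1)).card ≤
      ∑ i ∈ Finset.Icc r (k + r), (i - 1).choose (r - 1) *
        ∏ s ∈ Finset.range m, (2 * (k + r) + s * k - i).choose r := by
  have hsub : columnSets k r (m + 1) ⊆ (Finset.Icc r (k + r)).biUnion fun i =>
      (Finset.powersetCard (r - 1) (Finset.range (i - 1))).biUnion fun D =>
        columnSetsFrom k r (m + 1) (insert (i - 1) D) := by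
    intro E hE
    have hE' := hE
    rw [mem_columnSets] at hE
    obtain ⟨hEr, hEc, hEβ⟩ := hE
    obtain ⟨D, hDE, hD, hDlt⟩ := exists_initial_segment E r
      (by rw [hEc, Nat.add_mul]; omega)
    have hne : D.Nonempty := by rw [← Finset.card_pos]; omega
    have hx := Finset.max'_mem D hne
    set x := D.max' hne with hxdef
    have hxle : ∀ y ∈ D, y ≤ x := fun y hy => Finset.le_max' D y hy
    have hDr : D ⊆ Finset.range (x + 1) := fun y hy => by
      rw [Finset.mem_range]; have := hxle y hy; omega
    have hcle := Finset.card_le_card hDr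
    rw [hD, Finset.card_range] at hcle
    have hxn : x < k + r := by
      by_contra hxn
      have : E ∩ Finset.range (1 * (k + r)) ⊆ D.erase x := by
        intro y hy
        rw [Finset.mem_inter, Finset.mem_range] at hy
        rw [Finset.mem_erase]
        refine ⟨by omega, ?_⟩
        by_contra hyD
        have := hDlt x hx y hy.1 hyD
        omega
      have := Finset.card_le_card this
      have h2 := hEβ 1 (by omega)
      rw [Finset.card_erase_of_mem hx, hD] at this
      omega
    simp only [Finset.mem_biUnion, Finset.mem_Icc, Finset.mem_powersetCard]
    refine ⟨x + 1, ⟨hcle, by omega⟩, D.erase x, ⟨?_, ?_⟩, ?_⟩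
    · intro y hy
      rw [Finset.mem_erase] at hy
      have := hxle y hy.2
      rw [Finset.mem_range]
      omega
    · rw [Finset.card_erase_of_mem hx, hD]
    · rw [Nat.add_sub_cancel, Finset.insert_erase hx]
      exact Finset.mem_filter.2 ⟨hE', hDE, hDlt⟩
  refine (Finset.card_le_card hsub).trans (Finset.card_biUnion_le.trans ?_)
  refine Finset.sum_le_sum fun i hi => ?_
  rw [Finset.mem_Icc] at hi
  refine (Finset.card_biUnion_le_card_mul _ _
    (∏ s ∈ Finset.range m, (2 * (k + r) + s * k - i).choose r) fun D hD => ?_).trans_eq ?_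
  · rw [Finset.mem_powersetCard] at hD
    have hnot : i - 1 ∉ D := fun h => by simpa using hD.1 h
    have := card_columnSetsFrom_le (k := k) (D := insert (i - 1) D) (i := i - 1) hr
      (by rw [Finset.card_insert_of_notMem hnot, hD.2]; omega) (Finset.mem_insert_self _ _)
      (fun x hx => by
        rcases Finset.mem_insert.1 hx with rfl | hx
        · exact le_rfl
        · have := Finset.mem_range.1 (hD.1 hx); omega) (by omega) m
    rwa [Nat.sub_add_cancel (by omega)] at this
  · simp

/-- The hockey stick identity sums the first factors, and i ≥ r gives 2(k+r) + sk - i ≤ k + r +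
(s+1)k. -/
lemma sum_choose_mul_prod_le {k r : ℕ} (hr : 0 < r) (m : ℕ) :
    ∑ i ∈ Finset.Icc r (k + r), (i - 1).choose (r - 1) *
        ∏ s ∈ Finset.range m, (2 * (k + r) + s * k - i).choose r ≤
      ∏ s ∈ Finset.range (m + 1), (k + r + s * k).choose r := by
  obtain ⟨r, rfl⟩ : ∃ r', r = r' + 1 := ⟨r - 1, by omega⟩
  have hs : ∑ i ∈ Finset.Icc (r + 1) (k + (r + 1)), (i - 1).choose r =
      (k + (r + 1)).choose (r + 1) := by
    rw [← add_assoc, ← Nat.sum_Icc_choose, ← Finset.map_add_right_Icc, Finset.sum_map]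
    simp
  rw [Finset.prod_range_succ', zero_mul, add_zero, ← hs, Finset.mul_sum]
  refine Finset.sum_le_sum fun i hi => ?_
  rw [Finset.mem_Icc] at hi
  rw [mul_comm, Nat.add_sub_cancel]
  refine Nat.mul_le_mul_right _ ?_
  refine Finset.prod_le_prod' fun s _ => Nat.choose_le_choose _ ?_
  rw [Nat.add_mul]
  omega

lemma card_columnSets_mul_le_min {n k δ : ℕ} (hkn : k < n) :
    (columnSets k (n - k) (L n k δ + 1)).card * ((L n k δ + 1) * (n - k)) ≤
      min (M₁ n k δ) (min (M₂ n k δ) (M₃ n k δ)) := by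
  have hr : 0 < n - k := by omega
  have hn : k + (n - k) = n := by omega
  have h1 := card_columnSets_le_choose k (n - k) (L n k δ + 1)
  have h3 := card_columnSets_le_sum (k := k) hr (L n k δ)
  have h2 := h3.trans (sum_choose_mul_prod_le hr _)
  rw [hn] at h1 h2 h3
  rw [mul_comm]
  exact le_min (Nat.mul_le_mul_left _ h1)
    (le_min (Nat.mul_le_mul_left _ h2) (Nat.mul_le_mul_left _ h3))

/-! ### Hankel matrices acting on polynomials -/

section Realization

variable {K : Type*} [Field K]

/-- The pairing `∑ s_l f_l` of a sequence with a polynomial. -/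
def pairing (s : ℕ → K) : K[X] →ₗ[K] K := lsum fun l => s l • LinearMap.id

lemma pairing_C_mul_X_pow (s : ℕ → K) (c : K) (l : ℕ) : pairing s (C c * X ^ l) = s l * c := by
  rw [C_mul_X_pow_eq_monomial]
  simp [pairing, lsum, sum_monomial_index]

lemma pairing_X_pow (s : ℕ → K) (l : ℕ) : pairing s (X ^ l) = s l := by
  simpa using pairing_C_mul_X_pow s 1 l

lemma pairing_C_mul (s : ℕ → K) (c : K) (f : K[X]) : pairing s (C c * f) = c * pairing s f := by
  rw [C_mul', map_smul, smul_eq_mul]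

lemma pairing_eq_sum_range (s : ℕ → K) (f : K[X]) {N : ℕ} (hf : ∀ l, N ≤ l → f.coeff l = 0) :
    pairing s f = ∑ l ∈ Finset.range N, s l * f.coeff l := by
  have : pairing s f = f.sum fun l c => s l * c := by simp [pairing, lsum]
  rw [this, sum_eq_of_subset (s := Finset.range N) _ (by simp)]
  intro l hl
  rw [mem_support_iff] at hl
  rw [Finset.mem_range]
  by_contra h
  exact hl (hf l (not_lt.1 h))

lemma pairing_map {F : Type*} [Field F] (φ : F →+* K) (s : ℕ → F) (f : F[X]) :
    pairing (fun l => φ (s l)) (f.map φ) = φ (pairing s f) := by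
  induction f using Polynomial.induction_on' with
  | add f g hf hg => rw [Polynomial.map_add, map_add, map_add, map_add, hf, hg]
  | monomial n a =>
    rw [← C_mul_X_pow_eq_monomial, Polynomial.map_mul, Polynomial.map_pow, map_C, map_X,
      pairing_C_mul_X_pow, pairing_C_mul_X_pow, map_mul]

/-- Pairing with `(X - lam) f` in terms of sequences related by `S (l + 1) = t l + lam * S l`. -/
lemma pairing_X_sub_C_mul (S t : ℕ → K) (lam : K) (h : ∀ l, S (l + 1) = t l + lam * S l)
    (f : K[X]) : pairing S ((X - C lam) * f) = pairing t f := by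
  induction f using Polynomial.induction_on' with
  | add f g hf hg => rw [mul_add, map_add, map_add, hf, hg]
  | monomial n a =>
    rw [← C_mul_X_pow_eq_monomial, sub_mul, map_sub, pairing_C_mul, pairing_C_mul_X_pow,
      pairing_C_mul_X_pow, mul_left_comm, ← pow_succ', pairing_C_mul_X_pow, h]
    ring

/-- The sequence `∑_{i ≤ l} lam ^ i s_{l - i}`. -/
def hornerSeq (lam : K) (s : ℕ → K) : ℕ → K
  | 0 => s 0
  | l + 1 => s (l + 1) + lam * hornerSeq lam s l

lemma hornerSeq_zero (s : ℕ → K) (l : ℕ) : hornerSeq 0 s l = s l := by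
  cases l <;> simp [hornerSeq]

/-- Since `reflect D f` is z^D f(1/z), the coefficients beyond degree D of the product are rows of a
Hankel matrix applied to f. -/
lemma coeff_mk_mul_reflect (s : ℕ → K) (D i : ℕ) (f : K[X]) (hf : f.natDegree ≤ D) :
    PowerSeries.coeff (D + i) (PowerSeries.mk s * (reflect D f : PowerSeries K)) =
      pairing (fun l => s (i + l)) f := by
  refine induction_with_natDegree_le (fun f => PowerSeries.coeff (D + i)
    (PowerSeries.mk s * (reflect D f : PowerSeries K)) = pairing (fun l => s (i + l)) f) D ?_ ?_ ?_ f hf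
  · simp
  · intro l c _ hl
    rw [reflect_C_mul_X_pow, revAt_le hl, pairing_C_mul_X_pow]
    simp only [coe_mul, coe_C, coe_pow, coe_X]
    rw [mul_left_comm, PowerSeries.coeff_C_mul, PowerSeries.coeff_mul_X_pow', if_pos (by omega),
      PowerSeries.coeff_mk, mul_comm]
    congr 2
    omega
  · intro f g _ _ hf hg
    rw [reflect_add, coe_add, mul_add, map_add, map_add, hf, hg]

lemma eval_trunc_succ_mk (s : ℕ → K) (lam x : K) (h : x * lam = 1) (l : ℕ) :
    (PowerSeries.trunc (l + 1) (PowerSeries.mk s)).eval x = x ^ l * hornerSeq lam s l := by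
  induction l with
  | zero => simp [hornerSeq, PowerSeries.trunc_succ]
  | succ l ih =>
    rw [PowerSeries.trunc_succ, eval_add, ih, eval_monomial, PowerSeries.coeff_mk, hornerSeq]
    linear_combination (-hornerSeq lam s l * x ^ l) * h

lemma eval_trunc_mk_mul_reflect (s : ℕ → K) (lam x : K) (h : x * lam = 1) (D : ℕ) (f : K[X])
    (hf : f.natDegree ≤ D) :
    (PowerSeries.trunc (D + 1) (PowerSeries.mk s * (reflect D f : PowerSeries K))).eval x =
      x ^ D * pairing (hornerSeq lam s) f := by
  refine induction_with_natDegree_le (fun f =>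
    (PowerSeries.trunc (D + 1) (PowerSeries.mk s * (reflect D f : PowerSeries K))).eval x =
      x ^ D * pairing (hornerSeq lam s) f) D ?_ ?_ ?_ f hf
  · simp
  · intro l c _ hl
    rw [reflect_C_mul_X_pow, revAt_le hl, pairing_C_mul_X_pow]
    have : PowerSeries.trunc (D + 1) (PowerSeries.mk s * ((C c * X ^ (D - l) : K[X]) : PowerSeries K)) =
        C c * (PowerSeries.trunc (l + 1) (PowerSeries.mk s) * X ^ (D - l)) := by
      ext m
      simp only [coe_mul, coe_C, coe_pow, coe_X]
      rw [mul_left_comm, PowerSeries.coeff_trunc, PowerSeries.coeff_C_mul,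
        PowerSeries.coeff_mul_X_pow', coeff_C_mul, coeff_mul_X_pow', PowerSeries.coeff_trunc]
      split_ifs <;> first | rfl | omega | simp
    rw [this, eval_mul, eval_C, eval_mul, eval_trunc_succ_mk s lam x h, eval_pow, eval_X]
    have : x ^ D = x ^ l * x ^ (D - l) := by rw [← pow_add]; congr 1; omega
    rw [this]
    ring
  · intro f g _ _ hf hg
    rw [reflect_add, coe_add, mul_add, map_add, eval_add, map_add, hf, hg]
    ring

variable {ι κ : Type*} [Fintype κ]

/-- The Hankel matrix with entry `p (m + l + 1) i j` in row `(i, m)`, `m < e i`, and column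
`(j, l)`, `l < d j`, has trivial kernel. -/
def HankelInjective (d : κ → ℕ) (e : ι → ℕ) (p : ℕ → ι → κ → K) : Prop :=
  ∀ W : κ → ℕ → K,
    (∀ i, ∀ m < e i, ∑ j, ∑ l ∈ Finset.range (d j), p (m + l + 1) i j * W j l = 0) →
      ∀ j, ∀ l < d j, W j l = 0

/-- Write q = (X - lam) w. By `h1` the row m = 0 of the Hankel matrix kills w, and each relation in
`hpq` says that row m + 1 applied to w is lam times row m applied to w. So w is in the kernel. -/
lemma HankelInjective.eq_zero_of_eval_eq_zero {d : κ → ℕ} {e : ι → ℕ} {p : ℕ → ι → κ → K}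
    (hM : HankelInjective d e p) (q : κ → K[X]) (hq : ∀ j, (q j).natDegree ≤ d j)
    (hpq : ∀ i, ∀ m < e i, ∑ j, pairing (fun l => p (m + 1 + l) i j) (q j) = 0) (lam : K)
    (h0 : ∀ j, (q j).eval lam = 0)
    (h1 : ∀ i, ∑ j, pairing (hornerSeq lam fun l => p l i j) (q j) = 0) : q = 0 := by
  have hdvd : ∀ j, ∃ w, q j = (X - C lam) * w := fun j => dvd_iff_isRoot.2 (h0 j)
  choose w hw using hdvd
  have hwdeg : ∀ j l, d j ≤ l → (w j).coeff l = 0 := by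
    intro j l hl
    by_cases hwj : w j = 0
    · simp [hwj]
    have := hq j
    rw [hw j, natDegree_mul (X_sub_C_ne_zero lam) hwj, natDegree_X_sub_C] at this
    exact coeff_eq_zero_of_natDegree_lt (by omega)
  have hg : ∀ i, ∀ m ≤ e i, ∑ j, pairing (fun l => p (m + 1 + l) i j) (w j) = 0 := by
    intro i m
    induction m with
    | zero =>
      intro _
      rw [← h1 i]
      refine Finset.sum_congr rfl fun j _ => ?_
      rw [hw j, pairing_X_sub_C_mul _ (fun l => p (l + 1) i j) lam fun l => rfl]
      congr 2
      ext l
      congr 1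
      omega
    | succ m ih =>
      intro hm
      have h2 := hpq i m (by omega)
      have h3 : ∀ j, pairing (fun l => p (m + 1 + l) i j) (q j) =
          pairing (fun l => p (m + 1 + 1 + l) i j) (w j) -
            lam * pairing (fun l => p (m + 1 + l) i j) (w j) := by
        intro j
        rw [hw j, pairing_X_sub_C_mul _
          (fun l => p (m + 1 + 1 + l) i j - lam * p (m + 1 + l) i j) lam]
        · have : ∀ (s t : ℕ → K) f, pairing (fun l => s l - lam * t l) f =
              pairing s f - lam * pairing t f := by
            intro s t f
            induction f using Polynomial.induction_on' with
            | add f g hf hg => rw [map_add, map_add, map_add, hf, hg]; ring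
            | monomial n a =>
              rw [← C_mul_X_pow_eq_monomial]
              simp only [pairing_C_mul_X_pow]
              ring
          exact this _ _ _
        · intro l
          rw [show m + 1 + (l + 1) = m + 1 + 1 + l by omega]
          ring
      simp only [h3, Finset.sum_sub_distrib, ← Finset.mul_sum, ih (by omega)] at h2
      simpa using h2
  have hW := hM (fun j l => (w j).coeff l) fun i m hm => by
    rw [← hg i m hm.le]
    refine Finset.sum_congr rfl fun j _ => ?_
    rw [pairing_eq_sum_range _ _ (hwdeg j)]
    refine Finset.sum_congr rfl fun l _ => ?_
    congr 2
    omega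
  funext j
  have : w j = 0 := by
    ext l
    by_cases hl : l < d j
    · exact hW j l hl
    · exact hwdeg j l (not_lt.1 hl)
  rw [hw j, this, mul_zero, Pi.zero_apply]

lemma HankelInjective.exists_eq [Fintype ι] {d : κ → ℕ} {e : ι → ℕ} {p : ℕ → ι → κ → K}
    (hM : HankelInjective d e p) (hde : ∑ j, d j = ∑ i, e i) (τ : ι → ℕ → K) :
    ∃ W : κ → ℕ → K, ∀ i, ∀ m < e i,
      ∑ j, ∑ l ∈ Finset.range (d j), p (m + l + 1) i j * W j l = τ i m := by
  let f : ((Σ j, Fin (d j)) → K) →ₗ[K] ((Σ i, Fin (e i)) → K) :=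
    Matrix.mulVecLin (Matrix.of fun a b => p (a.2 + b.2 + 1) a.1 b.1)
  have hf : ∀ (W : κ → ℕ → K) a, f (fun b => W b.1 b.2) a =
      ∑ j, ∑ l ∈ Finset.range (d j), p (a.2 + l + 1) a.1 j * W j l := by
    intro W a
    simp only [f, Matrix.mulVecLin_apply, Matrix.mulVec, dotProduct, Matrix.of_apply]
    rw [Fintype.sum_sigma]
    refine Finset.sum_congr rfl fun j _ => ?_
    rw [Finset.sum_range]
  let ext (x : (Σ j, Fin (d j)) → K) (j : κ) (l : ℕ) : K := if h : l < d j then x ⟨j, l, h⟩ else 0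
  have hext : ∀ x, (fun b : Σ j, Fin (d j) => ext x b.1 b.2) = x := by
    intro x; funext b; simp [ext]
  have hinj : Function.Injective f := by
    rw [injective_iff_map_eq_zero]
    intro x hx
    have := hM (ext x) fun i m hm => by
      rw [← hf (ext x) ⟨i, m, hm⟩, hext, hx]; rfl
    rw [← hext x]
    funext b
    exact this b.1 b.2 b.2.2
  have hsurj := (LinearMap.injective_iff_surjective_of_finrank_eq_finrank (by
    simp [hde])).1 hinj
  obtain ⟨x, hx⟩ := hsurj fun a => τ a.1 a.2
  refine ⟨ext x, fun i m hm => ?_⟩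
  rw [← hf (ext x) ⟨i, m, hm⟩, hext, hx]

end Realization

/-! ### The generator matrix built from an invertible Hankel matrix -/

section Generator

variable {F : Type*} [Field F] {ι κ : Type*} [Fintype κ]

/-- `A` is a `κ × κ` polynomial matrix with row and column degrees `d`, with identity matrix of
leading row coefficients, such that the coefficient of `z^{-m}` in row `i` of `(∑ p_l z^{-l}) A(z)`
vanishes for `1 ≤ m ≤ e i`. -/
structure IsDenominator (d : κ → ℕ) (e : ι → ℕ) (p : ℕ → ι → κ → F) (A : κ → κ → F[X]) :
    Prop where
  natDegree_row : ∀ j' j, (A j' j).natDegree ≤ d j'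
  natDegree_col : ∀ j' j, (A j' j).natDegree ≤ d j
  coeff_diag : ∀ j, (A j j).coeff (d j) = 1
  coeff_offDiag : ∀ j' j, j' ≠ j → (A j' j).coeff (d j') = 0
  pairing_eq_zero : ∀ j i, ∀ m < e i, ∑ j', pairing (fun l => p (m + 1 + l) i j') (A j' j) = 0

/-- Column j is z^(d j) in position j minus a correction of degree < d j' in each position j', found
by solving the Hankel system. The row degrees are then clear; the column degrees need that the d j
differ by at most 1. -/
lemma exists_isDenominator [Fintype ι] {d : κ → ℕ} {e : ι → ℕ} {p : ℕ → ι → κ → F}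
    (hM : HankelInjective d e p) (hde : ∑ j, d j = ∑ i, e i) (hd : ∀ j j', d j' ≤ d j + 1) :
    ∃ A, IsDenominator d e p A := by
  classical
  choose c hc using fun j => hM.exists_eq hde fun i m => p (m + 1 + d j) i j
  let B : κ → κ → F[X] := fun j' j => ∑ l ∈ Finset.range (d j'), C (c j j' l) * X ^ l
  have hB : ∀ j' j n, (∀ l < d j', l ≤ n) → (B j' j).natDegree ≤ n := fun j' j n h =>
    natDegree_sum_le_of_forall_le _ _ fun l hl =>
      (natDegree_C_mul_X_pow_le _ _).trans (h l (Finset.mem_range.1 hl))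
  have hBc : ∀ j' j, (B j' j).coeff (d j') = 0 := by
    intro j' j
    simp only [B, finsetSum_coeff, coeff_C_mul_X_pow]
    refine Finset.sum_eq_zero fun l hl => if_neg ?_
    have := Finset.mem_range.1 hl
    omega
  have hI : ∀ j' j n, (j' = j → d j ≤ n) → (if j' = j then (X : F[X]) ^ d j else 0).natDegree ≤ n := by
    intro j' j n h
    split_ifs with hj
    · simpa using h hj
    · simp
  refine ⟨fun j' j => (if j' = j then X ^ d j else 0) - B j' j, ?_, ?_, ?_, ?_, ?_⟩
  · intro j' j
    refine (natDegree_sub_le _ _).trans (max_le (hI _ _ _ fun h => by rw [h]) ?_)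
    exact hB _ _ _ fun l hl => hl.le
  · intro j' j
    refine (natDegree_sub_le _ _).trans (max_le (hI _ _ _ fun h => le_rfl) ?_)
    exact hB _ _ _ fun l hl => by have := hd j j'; omega
  · intro j
    rw [coeff_sub, hBc]
    simp
  · intro j' j h
    rw [coeff_sub, hBc, if_neg h]
    simp
  · intro j i m hm
    simp only [map_sub, Finset.sum_sub_distrib]
    rw [Finset.sum_eq_single j (fun b _ hb => by simp [hb]) (by simp), if_pos rfl, pairing_X_pow,
      sub_eq_zero, ← hc j i m hm]
    refine Finset.sum_congr rfl fun j' _ => ?_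
    simp only [B, map_sum, pairing_C_mul_X_pow]
    refine Finset.sum_congr rfl fun l _ => ?_
    rw [show m + 1 + l = m + l + 1 by omega]

/-- The generator matrix `(Q, N)` with `Q` obtained from `A` by reversing the columns and `N` the
truncation of `(∑ p_l z^l) Q(z)` to the column degrees `d`. -/
def generator (d : κ → ℕ) (p : ℕ → ι → κ → F) (A : κ → κ → F[X]) : κ ⊕ ι → κ → F[X]
  | Sum.inl j', j => reflect (d j) (A j' j)
  | Sum.inr i, j => ∑ j', PowerSeries.trunc (d j + 1)
      (PowerSeries.mk (fun l => p l i j') * (reflect (d j) (A j' j) : PowerSeries F))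

variable {d : κ → ℕ} {e : ι → ℕ} {p : ℕ → ι → κ → F} {A : κ → κ → F[X]}

/-- The vector q = Aβ satisfies the hypotheses of `HankelInjective.eq_zero_of_eval_eq_zero`, and its
coefficient at d j' in position j' is β j'. -/
lemma IsDenominator.eq_zero {K : Type*} [Field K] (hA : IsDenominator d e p A) (φ : F →+* K)
    (hM : HankelInjective d e fun l i j => φ (p l i j)) (lam : K) (β : κ → K)
    (h0 : ∀ j', ∑ j, β j * (A j' j).eval₂ φ lam = 0)
    (h1 : ∀ i, ∑ j, β j * ∑ j', pairing (hornerSeq lam fun l => φ (p l i j')) ((A j' j).map φ) = 0) :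
    β = 0 := by
  have hpair : ∀ (s : κ → ℕ → K), ∑ j', pairing (s j') (∑ j, C (β j) * (A j' j).map φ) =
      ∑ j, β j * ∑ j', pairing (s j') ((A j' j).map φ) := by
    intro s
    simp only [map_sum, pairing_C_mul, Finset.mul_sum]
    exact Finset.sum_comm
  have hq := hM.eq_zero_of_eval_eq_zero (fun j' => ∑ j, C (β j) * (A j' j).map φ) (fun j' => ?_)
    (fun i m hm => ?_) lam (fun j' => ?_) (fun i => ?_)
  · funext j'
    have := congrArg (fun f => f.coeff (d j')) (congrFun hq j')
    simp only [finsetSum_coeff, coeff_C_mul, coeff_map, Pi.zero_apply, coeff_zero] at this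
    rw [Finset.sum_eq_single j' (fun j _ hj => by rw [hA.coeff_offDiag _ _ hj.symm]; simp)
      (by simp), hA.coeff_diag] at this
    simpa using this
  · refine natDegree_sum_le_of_forall_le _ _ fun j _ => (natDegree_C_mul_le _ _).trans ?_
    exact natDegree_map_le.trans (hA.natDegree_row _ _)
  · rw [hpair fun j' l => φ (p (m + 1 + l) i j')]
    refine Finset.sum_eq_zero fun j _ => ?_
    have := hA.pairing_eq_zero j i m hm
    simp only [pairing_map φ (fun l => p (m + 1 + l) i _), ← map_sum]
    rw [this, map_zero, mul_zero]
  · rw [eval_finsetSum, ← h0 j']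
    exact Finset.sum_congr rfl fun j _ => by rw [eval_mul, eval_C, eval_map]
  · rw [hpair fun j' => hornerSeq lam fun l => φ (p l i j')]
    exact h1 i

lemma natDegree_generator_le (hA : IsDenominator d e p A) (x : κ ⊕ ι) (j : κ) :
    (generator d p A x j).natDegree ≤ d j := by
  rcases x with j' | i
  · refine natDegree_le_iff_coeff_eq_zero.2 fun l hl => ?_
    rw [generator, coeff_reflect, revAt_eq_self_of_lt hl]
    exact coeff_eq_zero_of_natDegree_lt ((hA.natDegree_col _ _).trans_lt hl)
  · refine natDegree_sum_le_of_forall_le _ _ fun j' _ => ?_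
    exact Nat.lt_succ_iff.1 (PowerSeries.natDegree_trunc_lt _ _)

/-- Column reducedness: reversal turns the leading coefficients of the generator into values at 0,
so this is the case lam = 0. -/
lemma eq_zero_of_leadingCoeff (hA : IsDenominator d e p A) (hM : HankelInjective d e p)
    (α : κ → F) (h : ∀ x, ∑ j, (generator d p A x j).coeff (d j) * α j = 0) : α = 0 := by
  refine hA.eq_zero (RingHom.id F) hM 0 α (fun j' => ?_) (fun i => ?_)
  · refine Eq.trans (Finset.sum_congr rfl fun j _ => ?_) (h (Sum.inl j'))
    rw [generator, coeff_reflect, revAt_le le_rfl, Nat.sub_self, eval₂_id, ← coeff_zero_eq_eval_zero,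
      mul_comm]
  · refine Eq.trans (Finset.sum_congr rfl fun j _ => ?_) (h (Sum.inr i))
    rw [generator, finsetSum_coeff, mul_comm]
    congr 1
    refine Finset.sum_congr rfl fun j' _ => ?_
    rw [PowerSeries.coeff_trunc, if_pos (Nat.lt_succ_self _)]
    have := coeff_mk_mul_reflect (fun l => p l i j') (d j) 0 (A j' j) (hA.natDegree_col _ _)
    rw [add_zero] at this
    rw [this, Polynomial.map_id]
    congr 2
    ext l
    rw [hornerSeq_zero]
    simp

lemma map_trunc_mk_mul {K : Type*} [Field K] (φ : F →+* K) (n : ℕ) (s : ℕ → F) (f : F[X]) :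
    (PowerSeries.trunc n (PowerSeries.mk s * (f : PowerSeries F))).map φ =
      PowerSeries.trunc n (PowerSeries.mk (fun l => φ (s l)) * (f.map φ : PowerSeries K)) := by
  ext m
  rw [coeff_map, PowerSeries.coeff_trunc, PowerSeries.coeff_trunc]
  split_ifs
  · simp [PowerSeries.coeff_mul]
  · simp

/-- The entry of Q(0) at (j', j) is the coefficient of A j' j at d j. By the row degrees it vanishes
for d j > d j', and it is the identity where d j = d j'; so Q(0) is block unitriangular when ordered
by d. -/
lemma eq_zero_of_eval₂_zero_generator {K : Type*} [Field K] (hA : IsDenominator d e p A)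
    (φ : F →+* K) (α : κ → K)
    (h : ∀ j', ∑ j, (generator d p A (Sum.inl j') j).eval₂ φ 0 * α j = 0) : α = 0 := by
  have key : ∀ n j', d j' = n → α j' = 0 := by
    intro n
    induction n using Nat.strong_induction_on with
    | _ n ih =>
      intro j' hj'
      have := h j'
      rw [Finset.sum_eq_single j' (fun j _ hj => ?_) (by simp)] at this
      · rw [generator, eval₂_at_zero, coeff_reflect, revAt_le (Nat.zero_le _), Nat.sub_zero,
          hA.coeff_diag] at this
        simpa using this
      · rw [generator, eval₂_at_zero, coeff_reflect, revAt_le (Nat.zero_le _), Nat.sub_zero]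
        rcases lt_trichotomy (d j) (d j') with hlt | heq | hlt
        · rw [ih (d j) (hj' ▸ hlt) j rfl, mul_zero]
        · rw [heq, hA.coeff_offDiag _ _ hj.symm]
          simp
        · rw [coeff_eq_zero_of_natDegree_lt ((hA.natDegree_row _ _).trans_lt hlt)]
          simp
  funext j
  exact key _ j rfl

/-- For x ≠ 0, column j at x is x^(d j) times data of A at lam = 1/x, whence the rescaled vector
x^(d j) α j. -/
lemma eq_zero_of_eval₂_generator {K : Type*} [Field K] (hA : IsDenominator d e p A) (φ : F →+* K)
    (hM : HankelInjective d e fun l i j => φ (p l i j)) (x : K) (α : κ → K)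
    (h : ∀ y, ∑ j, (generator d p A y j).eval₂ φ x * α j = 0) : α = 0 := by
  by_cases hx : x = 0
  · subst hx
    exact eq_zero_of_eval₂_zero_generator hA φ α fun j' => h (Sum.inl j')
  · have hxl : x * x⁻¹ = 1 := mul_inv_cancel₀ hx
    have hβ : (fun j => x ^ d j * α j) = 0 := by
      refine hA.eq_zero φ hM x⁻¹ _ (fun j' => ?_) (fun i => ?_)
      · rw [← h (Sum.inl j')]
        refine Finset.sum_congr rfl fun j _ => ?_
        let _ : Invertible x⁻¹ := ⟨x, hxl, by rw [mul_comm]; exact hxl⟩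
        have := eval₂_reflect_mul_pow φ x⁻¹ (d j) (A j' j) (hA.natDegree_col _ _)
        change eval₂ φ x _ * _ = _ at this
        rw [generator, ← this, inv_pow]
        field_simp
      · rw [← h (Sum.inr i)]
        refine Finset.sum_congr rfl fun j _ => ?_
        rw [generator, eval₂_finsetSum, Finset.mul_sum, Finset.sum_mul]
        refine Finset.sum_congr rfl fun j' _ => ?_
        rw [← eval_map, map_trunc_mk_mul, ← reflect_map,
          eval_trunc_mk_mul_reflect _ _ _ hxl _ _ (natDegree_map_le.trans (hA.natDegree_col _ _))]
        ring
    funext j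
    have := congrFun hβ j
    simpa [hx] using this

/-- Truncating to degree d j loses nothing up to degree N: the coefficients of the power series in
degrees d j + 1, …, d j + e i vanish by the choice of A. -/
lemma coeff_generator_mul (hA : IsDenominator d e p A) {N : ℕ} (hN : ∀ i j, N ≤ d j + e i)
    (m : κ → F[X]) (i : ι) {t : ℕ} (ht : t ≤ N) :
    (∑ j, generator d p A (Sum.inr i) j * m j).coeff t =
      ∑ j', ∑ x ∈ Finset.HasAntidiagonal.antidiagonal t,
        p x.1 i j' * (∑ j, generator d p A (Sum.inl j') j * m j).coeff x.2 := by
  let P : κ → PowerSeries F := fun j' => PowerSeries.mk fun l => p l i j'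
  have hcol : ∀ j, ∀ t ≤ N, PowerSeries.coeff t ((generator d p A (Sum.inr i) j : F[X]) : PowerSeries F) =
      PowerSeries.coeff t (∑ j', P j' * (generator d p A (Sum.inl j') j : PowerSeries F)) := by
    intro j t ht
    rw [Polynomial.coeff_coe, map_sum, generator, finsetSum_coeff]
    by_cases htd : t < d j + 1
    · refine Finset.sum_congr rfl fun j' _ => ?_
      rw [PowerSeries.coeff_trunc, if_pos htd]
      rfl
    · simp only [PowerSeries.coeff_trunc, if_neg htd, Finset.sum_const_zero]
      obtain ⟨m, rfl⟩ : ∃ m, t = d j + (m + 1) := ⟨t - d j - 1, by omega⟩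
      rw [← hA.pairing_eq_zero j i m (by have := hN i j; omega)]
      refine Finset.sum_congr rfl fun j' _ => ?_
      exact (coeff_mk_mul_reflect (fun l => p l i j') _ (m + 1) _ (hA.natDegree_col _ _)).symm
  have h1 : (∑ j, generator d p A (Sum.inr i) j * m j).coeff t =
      PowerSeries.coeff t (∑ j, (∑ j', P j' * (generator d p A (Sum.inl j') j : PowerSeries F)) *
        (m j : PowerSeries F)) := by
    rw [finsetSum_coeff, map_sum]
    refine Finset.sum_congr rfl fun j _ => ?_
    rw [← Polynomial.coeff_coe, Polynomial.coe_mul, PowerSeries.coeff_mul, PowerSeries.coeff_mul]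
    refine Finset.sum_congr rfl fun x hx => ?_
    rw [hcol j x.1 ((Finset.HasAntidiagonal.antidiagonal.fst_le hx).trans ht)]
  have h2 : ∑ j, (∑ j', P j' * (generator d p A (Sum.inl j') j : PowerSeries F)) *
      (m j : PowerSeries F) =
        ∑ j', P j' * ((∑ j, generator d p A (Sum.inl j') j * m j : F[X]) : PowerSeries F) := by
    have hc : ∀ f : κ → F[X], ((∑ j, f j : F[X]) : PowerSeries F) = ∑ j, (f j : PowerSeries F) :=
      fun f => map_sum (coeToPowerSeries.ringHom (R := F)) f _
    simp only [hc, Polynomial.coe_mul, Finset.mul_sum, Finset.sum_mul]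
    rw [Finset.sum_comm]
    simp only [mul_assoc]
  rw [h1, h2, map_sum]
  refine Finset.sum_congr rfl fun j' _ => ?_
  rw [PowerSeries.coeff_mul]
  refine Finset.sum_congr rfl fun x _ => ?_
  rw [PowerSeries.coeff_mk, Polynomial.coeff_coe]

end Generator

/-! ### Degree and primeness from column reducedness and pointwise rank -/

section ColumnReduced

variable {F : Type*} [Field F]

lemma coeff_prod_sum_of_natDegree_le {R ι : Type*} [CommSemiring R] (s : Finset ι) (f : ι → R[X])
    (d : ι → ℕ) (h : ∀ i ∈ s, (f i).natDegree ≤ d i) :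
    (∏ i ∈ s, f i).natDegree ≤ ∑ i ∈ s, d i ∧
      (∏ i ∈ s, f i).coeff (∑ i ∈ s, d i) = ∏ i ∈ s, (f i).coeff (d i) := by
  classical
  induction s using Finset.induction_on with
  | empty => simp
  | insert a s ha ih =>
    obtain ⟨h1, h2⟩ := ih fun i hi => h i (Finset.mem_insert_of_mem hi)
    have h3 := h a (Finset.mem_insert_self _ _)
    rw [Finset.prod_insert ha, Finset.sum_insert ha, Finset.prod_insert ha]
    exact ⟨natDegree_mul_le_of_le h3 h1, by rw [coeff_mul_add_eq_of_natDegree_le h3 h1, h2]⟩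

lemma natDegree_det_le_and_coeff {k : ℕ} (A : Matrix (Fin k) (Fin k) F[X]) (d : Fin k → ℕ)
    (h : ∀ i j, (A i j).natDegree ≤ d j) :
    A.det.natDegree ≤ ∑ j, d j ∧
      A.det.coeff (∑ j, d j) = (Matrix.of fun i j => (A i j).coeff (d j)).det := by
  have hσ := fun σ : Equiv.Perm (Fin k) =>
    coeff_prod_sum_of_natDegree_le Finset.univ (fun j => A (σ j) j) d fun j _ => h _ _
  rw [Matrix.det_apply, Matrix.det_apply]
  constructor
  · refine natDegree_sum_le_of_forall_le _ _ fun σ _ => ?_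
    rw [Units.smul_def]
    exact (natDegree_smul_le _ _).trans (hσ σ).1
  · rw [finsetSum_coeff]
    refine Finset.sum_congr rfl fun σ _ => ?_
    rw [Units.smul_def, Units.smul_def, coeff_smul, (hσ σ).2]
    rfl

lemma exists_det_submatrix_ne_zero {n k : ℕ} (A : Matrix (Fin n) (Fin k) F)
    (h : ∀ α, A.mulVec α = 0 → α = 0) :
    ∃ e : Fin k ↪o Fin n, (A.submatrix e id).det ≠ 0 := by
  classical
  have hli : LinearIndependent F A.col := Matrix.mulVec_injective_iff.1 <|
    (injective_iff_map_eq_zero A.mulVecLin).2 h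
  have hrank : A.rank = k := by simpa using hli.rank_matrix
  obtain ⟨S, a, ha, hspan, hLI⟩ := exists_linearIndependent' F A.row
  have : Finite S := Finite.of_injective a ha
  have := Fintype.ofFinite S
  have hS : Fintype.card S = k := by
    have h1 := finrank_span_eq_card hLI
    rw [hspan, ← Matrix.rank_eq_finrank_span_row, hrank] at h1
    exact h1.symm
  have hcard : (Finset.univ.image a).card = k := by
    rw [Finset.card_image_of_injective _ ha, Finset.card_univ, hS]
  let e := (Finset.univ.image a).orderEmbOfFin hcard
  refine ⟨e, ?_⟩
  have hmem : ∀ i, ∃ x, a x = e i := fun i => by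
    obtain ⟨x, -, hx⟩ :=
      Finset.mem_image.1 (Finset.orderEmbOfFin_mem (Finset.univ.image a) hcard i)
    exact ⟨x, hx⟩
  choose b hb using hmem
  have hbinj : Function.Injective b := fun i j hij => e.injective (by rw [← hb, ← hb, hij])
  have hrow : LinearIndependent F (A.submatrix e id).row := by
    have hab : (A.submatrix e id).row = (A.row ∘ a) ∘ b := by
      funext i
      simp only [Function.comp, hb]
      rfl
    rw [hab]
    exact hLI.comp b hbinj
  exact ((Matrix.isUnit_iff_isUnit_det _).1
    (Matrix.linearIndependent_rows_iff_isUnit.1 hrow)).ne_zero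

variable {n k : ℕ}

/-- The matrix of leading column coefficients has a nonzero k × k minor, which is the coefficient at
∑ d j of the corresponding minor of G. -/
lemma minorDegree_eq (G : Matrix (Fin n) (Fin k) F[X]) (d : Fin k → ℕ)
    (hd : ∀ i j, (G i j).natDegree ≤ d j)
    (hlead : ∀ α : Fin k → F, (∀ i, ∑ j, (G i j).coeff (d j) * α j = 0) → α = 0) :
    (∃ e : Fin k ↪o Fin n, (G.submatrix e id).det ≠ 0) ∧ minorDegree G = ∑ j, d j := by
  obtain ⟨e, he⟩ := exists_det_submatrix_ne_zero (Matrix.of fun i j => (G i j).coeff (d j))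
    fun α hα => hlead α fun i => congrFun hα i
  have hdet := fun f : Fin k ↪o Fin n =>
    natDegree_det_le_and_coeff (G.submatrix f id) d fun i j => hd (f i) j
  have hne : (G.submatrix e id).det.coeff (∑ j, d j) ≠ 0 := by
    rw [(hdet e).2]
    exact he
  refine ⟨⟨e, fun h0 => hne (by rw [h0, coeff_zero])⟩, le_antisymm ?_ ?_⟩
  · exact Finset.sup_le fun f _ => (hdet f).1
  · exact (le_natDegree_of_ne_zero hne).trans
      (Finset.le_sup (f := fun f : Fin k ↪o Fin n => (G.submatrix f id).det.natDegree)
        (Finset.mem_univ e))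

lemma isGeneratorMatrix_range (G : Matrix (Fin n) (Fin k) F[X])
    (h : ∃ e : Fin k ↪o Fin n, (G.submatrix e id).det ≠ 0) :
    IsGeneratorMatrix G (LinearMap.range G.mulVecLin) := by
  obtain ⟨e, he⟩ := h
  refine ⟨Matrix.mulVec_injective_iff.1 <| (injective_iff_map_eq_zero G.mulVecLin).2
    fun v hv => Matrix.eq_zero_of_mulVec_eq_zero he ?_, rfl⟩
  funext i
  exact congrFun hv (e i)

lemma IsGeneratorMatrix.isConvolutionalCode {G : Matrix (Fin n) (Fin k) F[X]}
    {C : Submodule F[X] (Fin n → F[X])} (hG : IsGeneratorMatrix G C) {δ : ℕ}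
    (hδ : minorDegree G = δ) : IsConvolutionalCode k δ C := by
  refine ⟨inferInstance, ?_, G, hG, hδ⟩
  rw [hG.2, LinearMap.finrank_range_of_inj (Matrix.mulVec_injective_iff.2 hG.1)]
  simp

lemma isRightPrime_of_forall (G : Matrix (Fin n) (Fin k) F[X])
    (h : ∀ (x : AlgebraicClosure F) (α : Fin k → AlgebraicClosure F),
      (∀ i, ∑ j, (G i j).eval₂ (algebraMap F (AlgebraicClosure F)) x * α j = 0) → α = 0) :
    IsRightPrime G := by
  intro x
  have hli : LinearIndependent (AlgebraicClosure F) (G.map fun p => aeval x p).col :=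
    Matrix.mulVec_injective_iff.1 <| (injective_iff_map_eq_zero (Matrix.mulVecLin _)).2
      fun α hα => h x α fun i => congrFun hα i
  simpa using hli.rank_matrix

end ColumnReduced

lemma sum_range_mul_add {M : Type*} [AddCommMonoid M] (f : ℕ → M) (m n : ℕ) :
    ∑ x ∈ Finset.range (m * n), f x = ∑ t ∈ Finset.range m, ∑ c : Fin n, f (t * n + c) := by
  induction m with
  | zero => simp
  | succ m ih =>
    rw [Nat.add_mul, one_mul, Finset.sum_range_add, ih, Finset.sum_range_succ]
    congr 1
    rw [Finset.sum_range]

/-! ### Regular minors of the scalar Toeplitz matrix -/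

section Regular

variable {F : Type*} [Field F]

/-- The submatrix of the Toeplitz matrix of `s` with rows `Z` and columns `S` is square and
invertible. -/
def IsRegular (s : ℕ → F) (Z S : Finset ℕ) : Prop :=
  ∃ h : Z.card = S.card, (Matrix.of fun i j : Fin S.card =>
    lowerToeplitz s (Z.orderEmbOfFin h i) (S.orderEmbOfFin rfl j)).det ≠ 0

/-- `Z` and `S` have the same size and the elements of `Z` exceed those of `S` in order. -/
def Dominates (Z S : Finset ℕ) : Prop :=
  ∃ h : Z.card = S.card, ∀ i, S.orderEmbOfFin rfl i < Z.orderEmbOfFin h i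

lemma exists_isRegular {ι : Type*} (A : Finset ι) (Z S : ι → Finset ℕ)
    (h : ∀ a ∈ A, Dominates (Z a) (S a)) (B : ℕ) (hB : ∀ a ∈ A, (S a).card ≤ B)
    (hF : ((A.card * B : ℕ) : ℕ∞) < ENat.card F) :
    ∃ s : ℕ → F, ∀ a ∈ A, IsRegular s (Z a) (S a) := by
  have hF' : ((A.attach.card * B : ℕ) : ℕ∞) < ENat.card F := by rwa [Finset.card_attach]
  obtain ⟨s, hs⟩ := exists_lowerToeplitz_det_ne_zero (F := F) A.attach
    (fun a => (S a).card) (fun a => (Z a).orderEmbOfFin (h a a.2).choose)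
    (fun a => (S a).orderEmbOfFin rfl) (fun a _ => OrderEmbedding.strictMono _)
    (fun a _ => OrderEmbedding.strictMono _) (fun a _ => (h a a.2).choose_spec) B
    (fun a _ => hB a a.2) hF'
  exact ⟨s, fun a ha => ⟨_, hs ⟨a, ha⟩ (Finset.mem_attach _ _)⟩⟩

/-- The extension φ makes regularity over F usable over the algebraic closure. -/
lemma IsRegular.eq_zero {K : Type*} [Field K] (φ : F →+* K) {s : ℕ → F} {Z S : Finset ℕ}
    (h : IsRegular s Z S) (u : ℕ → K)
    (hu : ∀ x ∈ Z, ∑ y ∈ S, φ (lowerToeplitz s x y) * u y = 0) : ∀ y ∈ S, u y = 0 := by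
  obtain ⟨hc, hdet⟩ := h
  have hdet' : ((Matrix.of fun i j : Fin S.card => lowerToeplitz s (Z.orderEmbOfFin hc i)
      (S.orderEmbOfFin rfl j)).map φ).det ≠ 0 := by
    rw [← RingHom.mapMatrix_apply, ← RingHom.map_det]
    exact fun h0 => hdet (φ.injective (by rw [h0, map_zero]))
  have hsum : ∀ f : ℕ → K, ∑ y ∈ S, f y = ∑ j : Fin S.card, f (S.orderEmbOfFin rfl j) := by
    intro f
    conv_lhs => rw [← Finset.map_orderEmbOfFin_univ S rfl]
    rw [Finset.sum_map]
    rfl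
  have h0 := Matrix.eq_zero_of_mulVec_eq_zero (v := fun j => u (S.orderEmbOfFin rfl j)) hdet' (by
    funext i
    have := hu _ (Finset.orderEmbOfFin_mem Z hc i)
    rw [hsum] at this
    exact this)
  intro y hy
  rw [← Finset.mem_coe, ← Finset.range_orderEmbOfFin S rfl] at hy
  obtain ⟨j, rfl⟩ := hy
  exact congrFun h0 j

lemma card_filter_lt_orderEmbOfFin (S : Finset ℕ) {c : ℕ} (h : S.card = c) (i : Fin c) :
    (S.filter (· < S.orderEmbOfFin h i)).card = i := by
  have : S.filter (· < S.orderEmbOfFin h i) =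
      (Finset.Iio i).map (S.orderEmbOfFin h).toEmbedding := by
    ext x
    simp only [Finset.mem_filter, Finset.mem_map, Finset.mem_Iio]
    constructor
    · rintro ⟨hx, hlt⟩
      rw [← Finset.mem_coe, ← Finset.range_orderEmbOfFin S h] at hx
      obtain ⟨j, rfl⟩ := hx
      exact ⟨j, (S.orderEmbOfFin h).lt_iff_lt.1 hlt, rfl⟩
    · rintro ⟨j, hj, rfl⟩
      exact ⟨Finset.orderEmbOfFin_mem _ _ _, (S.orderEmbOfFin h).lt_iff_lt.2 hj⟩
  rw [this, Finset.card_map, Fin.card_Iio]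

end Regular

/-! ### Input and output positions, and the weight bound -/

section Positions

/-- The output positions of the first `m` blocks. -/
def outputs (k r m : ℕ) : Finset ℕ :=
  (Finset.range (m * (k + r))).filter fun x => k ≤ x % (k + r)

/-- The output positions of the first `m` blocks that are not in `E`. -/
def missingOutputs (k r m : ℕ) (E : Finset ℕ) : Finset ℕ := outputs k r m \ E

/-- The input positions in `E`. -/
def inputs (k r : ℕ) (E : Finset ℕ) : Finset ℕ := E.filter fun x => x % (k + r) < k

variable {k r : ℕ}

lemma card_outputs (m : ℕ) : (outputs k r m).card = m * r := by
  rw [outputs, Finset.card_filter, sum_range_mul_add, ← smul_eq_mul]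
  rw [Finset.sum_eq_card_nsmul (b := r), Finset.card_range]
  intro t _
  rw [Fin.sum_univ_add]
  have h1 : ∀ i : Fin k, (t * (k + r) + (i : ℕ)) % (k + r) = i := fun i => by
    rw [Nat.mul_add_mod_self_right, Nat.mod_eq_of_lt (by omega)]
  have h2 : ∀ i : Fin r, (t * (k + r) + (k + (i : ℕ))) % (k + r) = k + i := fun i => by
    rw [Nat.mul_add_mod_self_right, Nat.mod_eq_of_lt (by omega)]
  simp [h1, h2]

lemma outputs_mono {m m' : ℕ} (h : m ≤ m') : outputs k r m ⊆ outputs k r m' :=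
  Finset.filter_subset_filter _ (Finset.range_subset_range.2 (Nat.mul_le_mul_right _ h))

lemma outputs_inter_range {m β : ℕ} (h : β ≤ m) :
    outputs k r m ∩ Finset.range (β * (k + r)) = outputs k r β := by
  have : β * (k + r) ≤ m * (k + r) := Nat.mul_le_mul_right _ h
  ext x
  simp only [outputs, Finset.mem_inter, Finset.mem_filter, Finset.mem_range]
  constructor
  · rintro ⟨⟨-, h2⟩, h3⟩
    exact ⟨h3, h2⟩
  · rintro ⟨h1, h2⟩
    exact ⟨⟨by omega, h2⟩, h1⟩

/-- In the first β blocks, the outputs in E and the missing outputs together make up all βr outputs.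
-/
lemma card_inputs_inter_add {m β : ℕ} {E : Finset ℕ} (hE : E ⊆ Finset.range (m * (k + r)))
    (h : β ≤ m) :
    (E ∩ Finset.range (β * (k + r))).card +
      (missingOutputs k r m E ∩ Finset.range (β * (k + r))).card =
      (inputs k r E ∩ Finset.range (β * (k + r))).card + β * r := by
  set R := Finset.range (β * (k + r))
  have h1 : E ∩ R = (inputs k r E ∩ R) ∪ (outputs k r β ∩ E) := by
    ext x
    have := @hE x
    simp only [outputs, inputs, R, Finset.mem_inter, Finset.mem_union, Finset.mem_filter,
      Finset.mem_range] at this ⊢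
    by_cases h1 : x % (k + r) < k
    · simp [h1]
    · simp [h1, not_lt.1 h1]
      tauto
  have h2 : Disjoint (inputs k r E ∩ R) (outputs k r β ∩ E) := by
    rw [Finset.disjoint_left]
    intro x hx hx'
    simp only [outputs, inputs, Finset.mem_inter, Finset.mem_filter] at hx hx'
    omega
  have h3 : missingOutputs k r m E ∩ R = outputs k r β \ E := by
    rw [missingOutputs, ← outputs_inter_range h, Finset.sdiff_inter_right_comm]
  have h4 := Finset.card_inter_add_card_sdiff (outputs k r β) E
  rw [card_outputs] at h4
  rw [h1, Finset.card_union_of_disjoint h2, h3]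
  omega

/-- Inputs precede outputs within a block, so if the i-th input were not before the i-th missing
output, it would lie in a later block. Up to the block of that output there would be more missing
outputs than inputs of E, and E would have too few elements there. -/
lemma dominates_of_mem_columnSets {m : ℕ} {E : Finset ℕ} (hE : E ∈ columnSets k r m) :
    Dominates (missingOutputs k r m E) (inputs k r E) := by
  rw [mem_columnSets] at hE
  obtain ⟨hEr, hEc, hEβ⟩ := hE
  have hZr : missingOutputs k r m E ⊆ Finset.range (m * (k + r)) :=
    Finset.sdiff_subset.trans (Finset.filter_subset _ _)
  have hSr : inputs k r E ⊆ Finset.range (m * (k + r)) := (Finset.filter_subset _ _).trans hEr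
  have hcard : (missingOutputs k r m E).card = (inputs k r E).card := by
    have := card_inputs_inter_add hEr le_rfl
    rw [Finset.inter_eq_left.2 hEr, Finset.inter_eq_left.2 hZr, Finset.inter_eq_left.2 hSr] at this
    omega
  refine ⟨hcard, fun i => ?_⟩
  by_contra! hle
  set z := (missingOutputs k r m E).orderEmbOfFin hcard i with hz
  set y := (inputs k r E).orderEmbOfFin rfl i with hy
  have hzmem : z ∈ missingOutputs k r m E := Finset.orderEmbOfFin_mem _ _ _
  have hymem : y ∈ inputs k r E := Finset.orderEmbOfFin_mem _ _ _
  have hzm := Finset.mem_range.1 (hZr hzmem)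
  simp only [missingOutputs, outputs, Finset.mem_sdiff, Finset.mem_filter] at hzmem
  simp only [inputs, Finset.mem_filter] at hymem
  have hn : 0 < k + r := by omega
  set β := z / (k + r)
  have hz1 : β * (k + r) + z % (k + r) = z := Nat.div_add_mod' z _
  have hz2 := Nat.mod_lt z hn
  have hy1 : y / (k + r) * (k + r) + y % (k + r) = y := Nat.div_add_mod' y _
  have hβm : β + 1 ≤ m := (Nat.div_lt_iff_lt_mul hn).2 hzm
  have hyβ : (β + 1) * (k + r) ≤ y := by
    by_contra hlt
    have h1 : y / (k + r) = β := by
      apply le_antisymm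
      · exact Nat.lt_succ_iff.1 ((Nat.div_lt_iff_lt_mul hn).2 (not_le.1 hlt))
      · exact Nat.div_le_div_right hle
    rw [h1] at hy1
    omega
  have h1 := card_inputs_inter_add hEr hβm
  have h2 := hEβ _ hβm
  have h3 : (inputs k r E ∩ Finset.range ((β + 1) * (k + r))).card ≤ i := by
    rw [← card_filter_lt_orderEmbOfFin (inputs k r E) rfl i]
    refine Finset.card_le_card fun x hx => ?_
    rw [Finset.mem_inter, Finset.mem_range] at hx
    exact Finset.mem_filter.2 ⟨hx.1, by omega⟩
  have h4 : (i : ℕ) + 1 ≤ (missingOutputs k r m E ∩ Finset.range ((β + 1) * (k + r))).card := by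
    have h5 : z ∉ (missingOutputs k r m E).filter (· < z) := by simp
    rw [← card_filter_lt_orderEmbOfFin (missingOutputs k r m E) hcard i, ← hz,
      ← Finset.card_insert_of_notMem h5]
    refine Finset.card_le_card fun x hx => ?_
    have hzlt : z < (β + 1) * (k + r) := by rw [Nat.add_mul]; omega
    rw [Finset.mem_inter, Finset.mem_range]
    rcases Finset.mem_insert.1 hx with rfl | hx
    · exact ⟨Finset.orderEmbOfFin_mem _ _ _, hzlt⟩
    · rw [Finset.mem_filter] at hx
      exact ⟨hx.1, by omega⟩
  omega

lemma card_inputs_le {m : ℕ} {E : Finset ℕ} (hE : E ∈ columnSets k r m) :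
    (inputs k r E).card ≤ m * r := by
  rw [← (mem_columnSets.1 hE).2.1]
  exact Finset.card_filter_le _ _

lemma outputs_mem_columnSets (m : ℕ) : outputs k r m ∈ columnSets k r m := by
  refine mem_columnSets.2 ⟨Finset.filter_subset _ _, card_outputs m, fun β hβ => ?_⟩
  rw [outputs_inter_range hβ, card_outputs]

lemma inputs_outputs (m : ℕ) : inputs k r (outputs k r m) = ∅ := by
  rw [inputs, Finset.filter_eq_empty_iff]
  intro x hx
  simp only [outputs, Finset.mem_filter] at hx
  omega

/-- A vector in the row space of the truncated sliding generator matrix has weight at least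
`r (j + 1) + 1` in the first `j + 1` blocks, if it does not vanish in the first block. -/
lemma lt_card_support {F : Type*} [Field F] [DecidableEq F] {m : ℕ} (s : ℕ → F)
    (hreg : ∀ E ∈ columnSets k r m, IsRegular s (missingOutputs k r m E) (inputs k r E))
    (w : ℕ → F)
    (hw : ∀ x ∈ outputs k r m, w x =
      ∑ y ∈ inputs k r (Finset.range (m * (k + r))), lowerToeplitz s x y * w y)
    (h0 : ∃ y < k, w y ≠ 0) (j : ℕ) (hj : j < m) :
    (j + 1) * r < ((Finset.range ((j + 1) * (k + r))).filter (w · ≠ 0)).card := by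
  induction j using Nat.strong_induction_on with
  | _ j ih =>
    -- If the weight is too small, the support fits into a set E of (j+1)r positions. Adding all
    -- outputs of the later blocks gives a member of `columnSets`; the induction hypothesis supplies
    -- the conditions for β ≤ j.
    by_contra! hle
    obtain ⟨E, hUE, hER, hEc⟩ := Finset.exists_subsuperset_card_eq
      (Finset.filter_subset (w · ≠ 0) (Finset.range ((j + 1) * (k + r)))) hle (by simp)
    have hO : ∀ β ≤ m, j + 1 ≤ β → Disjoint E (outputs k r β \ outputs k r (j + 1)) ∧
        (outputs k r β \ outputs k r (j + 1)).card = β * r - (j + 1) * r := by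
      intro β _ hβj
      constructor
      · rw [Finset.disjoint_left]
        intro x hx hx'
        have := hER hx
        simp only [outputs, Finset.mem_sdiff, Finset.mem_filter] at hx'
        tauto
      · rw [Finset.card_sdiff_of_subset (outputs_mono hβj), card_outputs, card_outputs]
    have hmul : ∀ {β}, j + 1 ≤ β → (j + 1) * r ≤ β * r := fun h => Nat.mul_le_mul_right _ h
    have hmem : E ∪ (outputs k r m \ outputs k r (j + 1)) ∈ columnSets k r m := by
      rw [mem_columnSets]
      refine ⟨Finset.union_subset (hER.trans ?_) (Finset.sdiff_subset.trans
        (Finset.filter_subset _ _)), ?_, fun β hβ => ?_⟩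
      · exact Finset.range_subset_range.2 (Nat.mul_le_mul_right _ hj)
      · obtain ⟨h1, h2⟩ := hO m le_rfl hj
        rw [Finset.card_union_of_disjoint h1, hEc, h2]
        have := hmul (β := m) hj
        omega
      · by_cases hβj : j + 1 ≤ β
        · obtain ⟨h1, h2⟩ := hO β hβ hβj
          have : E ∪ (outputs k r β \ outputs k r (j + 1)) ⊆
              (E ∪ (outputs k r m \ outputs k r (j + 1))) ∩ Finset.range (β * (k + r)) := by
            refine Finset.subset_inter (Finset.union_subset_union_right
              (Finset.sdiff_subset_sdiff (outputs_mono hβ) subset_rfl)) (Finset.union_subset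
                (hER.trans ?_) (Finset.sdiff_subset.trans (Finset.filter_subset _ _)))
            exact Finset.range_subset_range.2 (Nat.mul_le_mul_right _ hβj)
          refine le_trans ?_ (Finset.card_le_card this)
          rw [Finset.card_union_of_disjoint h1, hEc, h2]
          have := hmul hβj
          omega
        · rcases Nat.eq_zero_or_pos β with rfl | hpos
          · simp
          · obtain ⟨γ, rfl⟩ : ∃ γ, β = γ + 1 := ⟨β - 1, by omega⟩
            refine (ih γ (by omega) (by omega)).le.trans (Finset.card_le_card fun x hx => ?_)
            rw [Finset.mem_filter] at hx
            refine Finset.mem_inter.2 ⟨Finset.mem_union_left _ (hUE (Finset.mem_filter.2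
              ⟨Finset.range_subset_range.2 (Nat.mul_le_mul_right _ (by omega)) hx.1, hx.2⟩)), hx.1⟩
    -- The missing outputs all lie in the first j + 1 blocks outside the support, so w vanishes
    -- there; regularity then forces w to vanish on the inputs of the set.
    have hzero := (hreg _ hmem).eq_zero (RingHom.id F) w fun x hx => ?_
    · obtain ⟨y, hyk, hy⟩ := h0
      refine hy (hzero y (Finset.mem_filter.2 ⟨Finset.mem_union_left _ (hUE ?_), ?_⟩))
      · refine Finset.mem_filter.2 ⟨Finset.mem_range.2 ?_, hy⟩
        rw [Nat.add_mul]
        omega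
      · rwa [Nat.mod_eq_of_lt (by omega)]
    · rw [missingOutputs, Finset.mem_sdiff, Finset.mem_union, not_or, Finset.mem_sdiff] at hx
      obtain ⟨hxO, hxE, hxj⟩ := hx
      have hxj : x ∈ outputs k r (j + 1) := by tauto
      have hxr := (Finset.mem_filter.1 hxj).1
      have hwx : w x = 0 := by
        by_contra hne
        exact hxE (hUE (Finset.mem_filter.2 ⟨hxr, hne⟩))
      rw [← hwx, hw x hxO]
      refine Finset.sum_subset (Finset.filter_subset_filter _ (mem_columnSets.1 hmem).1)
        fun y hy hyE => ?_
      rw [RingHom.id_apply]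
      by_cases hyj : y < (j + 1) * (k + r)
      · have : w y = 0 := by
          by_contra hne
          refine hyE (Finset.mem_filter.2 ⟨Finset.mem_union_left _ (hUE (Finset.mem_filter.2
            ⟨Finset.mem_range.2 hyj, hne⟩)), (Finset.mem_filter.1 hy).2⟩)
        rw [this, mul_zero]
      · rw [Finset.mem_range] at hxr
        rw [lowerToeplitz, if_neg (by omega), zero_mul]

end Positions

/-! ### The Hankel matrix as a Toeplitz minor -/

section Hankel

variable {k r : ℕ}

lemma mul_add_div_eq {n c : ℕ} (t : ℕ) (hc : c < n) : (t * n + c) / n = t := by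
  rw [mul_comm, Nat.mul_add_div (by omega), Nat.div_eq_of_lt hc, add_zero]

lemma mul_add_mod_eq {n c : ℕ} (t : ℕ) (hc : c < n) : (t * n + c) % n = c := by
  rw [Nat.mul_add_mod_self_right, Nat.mod_eq_of_lt hc]

/-- The positions of the rows of the Hankel matrix with row degrees `e` in the Toeplitz matrix. -/
def hankelRows (k : ℕ) (e : Fin r → ℕ) (a : ℕ) : Finset ℕ :=
  Finset.univ.image fun x : Σ i, Fin (e i) => (x.2 + a + 1) * (k + r) + (k + x.1)

/-- The positions of the columns of the Hankel matrix with column degrees `d` in the Toeplitz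
matrix. -/
def hankelCols (r : ℕ) (d : Fin k → ℕ) (a : ℕ) : Finset ℕ :=
  Finset.univ.image fun x : Σ j, Fin (d j) => (a - x.2) * (k + r) + x.1

lemma hankelRows_injective (e : Fin r → ℕ) (a : ℕ) : Function.Injective
    fun x : Σ i, Fin (e i) => ((x.2 : ℕ) + a + 1) * (k + r) + (k + x.1) := by
  rintro ⟨i, m⟩ ⟨i', m'⟩ h
  have h1 := congrArg (· / (k + r)) h
  have h2 := congrArg (· % (k + r)) h
  simp only [mul_add_div_eq _ (show k + (i : ℕ) < k + r by omega),
    mul_add_div_eq _ (show k + (i' : ℕ) < k + r by omega),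
    mul_add_mod_eq _ (show k + (i : ℕ) < k + r by omega),
    mul_add_mod_eq _ (show k + (i' : ℕ) < k + r by omega)] at h1 h2
  obtain rfl : i = i' := Fin.ext (by omega)
  obtain rfl : m = m' := Fin.ext (by omega)
  rfl

lemma hankelCols_injective (d : Fin k → ℕ) (a : ℕ) (hd : ∀ j, d j ≤ a + 1) : Function.Injective
    fun x : Σ j, Fin (d j) => (a - (x.2 : ℕ)) * (k + r) + (x.1 : ℕ) := by
  rintro ⟨j, l⟩ ⟨j', l'⟩ h
  have h1 := congrArg (· / (k + r)) h
  have h2 := congrArg (· % (k + r)) h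
  simp only [mul_add_div_eq _ (show (j : ℕ) < k + r by omega),
    mul_add_div_eq _ (show (j' : ℕ) < k + r by omega),
    mul_add_mod_eq _ (show (j : ℕ) < k + r by omega),
    mul_add_mod_eq _ (show (j' : ℕ) < k + r by omega)] at h1 h2
  obtain rfl : j = j' := Fin.ext (by omega)
  have := hd j
  obtain rfl : l = l' := Fin.ext (by omega)
  rfl

lemma card_hankelCols (d : Fin k → ℕ) (a : ℕ) (hd : ∀ j, d j ≤ a + 1) :
    (hankelCols r d a).card = ∑ j, d j := by
  rw [hankelCols, Finset.card_image_of_injective _ (hankelCols_injective d a hd)]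
  simp

/-- All rows lie in blocks ≥ a + 1 and all columns in blocks ≤ a. -/
lemma dominates_hankel (d : Fin k → ℕ) (e : Fin r → ℕ) (a : ℕ) (hd : ∀ j, d j ≤ a + 1)
    (hde : ∑ j, d j = ∑ i, e i) : Dominates (hankelRows k e a) (hankelCols r d a) := by
  have hc : (hankelRows k e a).card = (hankelCols r d a).card := by
    rw [card_hankelCols d a hd, hde, hankelRows,
      Finset.card_image_of_injective _ (hankelRows_injective e a)]
    simp
  refine ⟨hc, fun i => ?_⟩
  have h1 := Finset.orderEmbOfFin_mem (hankelRows k e a) hc i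
  have h2 := Finset.orderEmbOfFin_mem (hankelCols r d a) rfl i
  obtain ⟨⟨i', m⟩, -, h1⟩ := Finset.mem_image.1 h1
  obtain ⟨⟨j, l⟩, -, h2⟩ := Finset.mem_image.1 h2
  rw [← h1, ← h2]
  have h3 : (a - (l : ℕ)) * (k + r) ≤ ((m : ℕ) + a) * (k + r) := Nat.mul_le_mul_right _ (by omega)
  rw [Nat.add_mul _ 1]
  dsimp only
  omega

/-- The coefficients of the `r × k` block Toeplitz matrix inside the Toeplitz matrix of `s`. -/
def blockSeq {R : Type*} (k r : ℕ) (s : ℕ → R) (l : ℕ) (i : Fin r) (j : Fin k) : R :=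
  s (l * (k + r) + k + i - j)

lemma lowerToeplitz_eq_blockSeq {R : Type*} [Zero R] (s : ℕ → R) {t b : ℕ} (h : b ≤ t) (i : Fin r)
    (j : Fin k) : lowerToeplitz s (t * (k + r) + (k + i)) (b * (k + r) + j) =
      blockSeq k r s (t - b) i j := by
  obtain ⟨c, rfl⟩ := Nat.exists_eq_add_of_le h
  rw [lowerToeplitz, blockSeq, if_pos, Nat.add_sub_cancel_left, Nat.add_mul]
  · congr 1
    omega
  · rw [Nat.add_mul]
    omega

lemma lowerToeplitz_eq_zero {R : Type*} [Zero R] (s : ℕ → R) {t b : ℕ} (h : t < b) (i : Fin r)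
    (j : Fin k) : lowerToeplitz s (t * (k + r) + (k + i)) (b * (k + r) + j) = 0 := by
  obtain ⟨c, rfl⟩ : ∃ c, b = t + 1 + c := Nat.exists_eq_add_of_le h
  rw [lowerToeplitz, if_neg]
  rw [Nat.add_mul, Nat.add_mul]
  omega

lemma hankelInjective_of_isRegular {F K : Type*} [Field F] [Field K] (φ : F →+* K) (s : ℕ → F)
    (d : Fin k → ℕ) (e : Fin r → ℕ) (a : ℕ) (hd : ∀ j, d j ≤ a + 1)
    (h : IsRegular s (hankelRows k e a) (hankelCols r d a)) :
    HankelInjective d e fun l i j => φ (blockSeq k r s l i j) := by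
  intro W hW
  -- The entry W j l sits at input j of block a - l. This reversal turns the block difference (m + a
  -- + 1) - (a - l) into the Hankel index m + l + 1; d j ≤ a + 1 keeps a - l exact.
  let u : ℕ → K := fun y =>
    if h : y % (k + r) < k then W ⟨y % (k + r), h⟩ (a - y / (k + r)) else 0
  have hu : ∀ (j : Fin k) (l : ℕ), l < d j → u ((a - l) * (k + r) + j) = W j l := by
    intro j l hl
    have h1 := mul_add_div_eq (a - l) (show (j : ℕ) < k + r by omega)
    have h2 := mul_add_mod_eq (a - l) (show (j : ℕ) < k + r by omega)
    have := hd j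
    simp only [u, h1, h2, Fin.is_lt, dif_pos]
    congr 1
    omega
  have h0 := h.eq_zero φ u fun x hx => ?_
  · intro j l hl
    rw [← hu j l hl]
    exact h0 _ (Finset.mem_image.2 ⟨⟨j, l, hl⟩, Finset.mem_univ _, rfl⟩)
  · rw [hankelRows, Finset.mem_image] at hx
    obtain ⟨⟨i, m⟩, -, rfl⟩ := hx
    rw [hankelCols, Finset.sum_image (hankelCols_injective d a hd).injOn, Fintype.sum_sigma,
      ← hW i m m.2]
    refine Finset.sum_congr rfl fun j _ => ?_
    rw [Finset.sum_range]
    refine Finset.sum_congr rfl fun l _ => ?_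
    have := hd j
    rw [hu j l l.2]
    dsimp only
    rw [lowerToeplitz_eq_blockSeq s (by omega)]
    congr 4
    omega

end Hankel

/-! ### Codewords as scalar sequences -/

section Flatten

variable {F : Type*} [Field F] {n : ℕ}

/-- The sequence of all coefficients of `v`, one coefficient vector after the other. -/
def flatten (hn : 0 < n) (v : Fin n → F[X]) (x : ℕ) : F :=
  (v ⟨x % n, Nat.mod_lt _ hn⟩).coeff (x / n)

lemma flatten_mul_add (hn : 0 < n) (v : Fin n → F[X]) (t : ℕ) (c : Fin n) :
    flatten hn v (t * n + c) = (v c).coeff t := by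
  simp only [flatten, mul_add_div_eq t c.2, mul_add_mod_eq t c.2]

lemma truncWeight_eq_card [DecidableEq F] (hn : 0 < n) (v : Fin n → F[X]) (j : ℕ) :
    truncWeight v j =
      ((Finset.range ((j + 1) * n)).filter (flatten hn v · ≠ 0)).card := by
  rw [Finset.card_filter, sum_range_mul_add, truncWeight]
  refine Finset.sum_congr rfl fun t _ => ?_
  simp only [hammingNorm, Finset.card_filter]
  refine Finset.sum_congr rfl fun c _ => ?_
  rw [flatten_mul_add]
  by_cases h : (v c).coeff t = 0 <;> simp [coeffVec, h]

end Flatten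

/-! ### Column distances of the constructed code -/

section MDP

variable {F : Type*} [Field F] {k r : ℕ} {d : Fin k → ℕ} {e : Fin r → ℕ} {s : ℕ → F}
  {A : Fin k → Fin k → F[X]}

/-- The generator matrix with rows indexed by `Fin (k + r)`. -/
def generatorMatrix (d : Fin k → ℕ) (s : ℕ → F) (A : Fin k → Fin k → F[X]) :
    Matrix (Fin (k + r)) (Fin k) F[X] :=
  Matrix.of fun x j => generator d (blockSeq k r s) A (finSumFinEquiv.symm x) j

lemma generatorMatrix_mulVec (m : Fin k → F[X]) (x : Fin k ⊕ Fin r) :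
    (generatorMatrix d s A).mulVec m (finSumFinEquiv x) =
      ∑ j, generator d (blockSeq k r s) A x j * m j := by
  simp [generatorMatrix, Matrix.mulVec, dotProduct]

lemma flatten_mulVec_eq_sum (hn : 0 < k + r) (hA : IsDenominator d e (blockSeq k r s) A) {N : ℕ}
    (hN : ∀ i j, N ≤ d j + e i) (m : Fin k → F[X]) :
    ∀ x ∈ outputs k r (N + 1), flatten hn ((generatorMatrix d s A).mulVec m) x =
      ∑ y ∈ inputs k r (Finset.range ((N + 1) * (k + r))), lowerToeplitz s x y *
        flatten hn ((generatorMatrix d s A).mulVec m) y := by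
  intro x hx
  rw [outputs, Finset.mem_filter, Finset.mem_range] at hx
  have hmod := Nat.mod_lt x hn
  obtain ⟨t, i, rfl⟩ : ∃ (t : ℕ) (i : Fin r), x = t * (k + r) + (k + i) := by
    refine ⟨x / (k + r), ⟨x % (k + r) - k, by omega⟩, ?_⟩
    have := Nat.div_add_mod' x (k + r)
    dsimp only
    omega
  have ht : t < N + 1 := by
    by_contra h
    have := Nat.mul_le_mul_right (k + r) (not_lt.1 h)
    omega
  rw [inputs, Finset.sum_filter, sum_range_mul_add]
  have h1 := flatten_mul_add hn ((generatorMatrix d s A).mulVec m) t (finSumFinEquiv (Sum.inr i))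
  rw [finSumFinEquiv_apply_right, Fin.val_natAdd] at h1
  rw [h1, ← finSumFinEquiv_apply_right, generatorMatrix_mulVec,
    coeff_generator_mul hA hN m i (Nat.lt_succ_iff.1 ht)]
  have h2 : ∀ b, (∑ c : Fin (k + r), if (b * (k + r) + (c : ℕ)) % (k + r) < k then
      lowerToeplitz s (t * (k + r) + (k + i)) (b * (k + r) + c) *
        flatten hn ((generatorMatrix d s A).mulVec m) (b * (k + r) + c) else 0) =
      ∑ j : Fin k, lowerToeplitz s (t * (k + r) + (k + i)) (b * (k + r) + j) *
        (∑ j', generator d (blockSeq k r s) A (Sum.inl j) j' * m j').coeff b := by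
    intro b
    simp only [mul_add_mod_eq _ (Fin.is_lt _), flatten_mul_add]
    rw [Fin.sum_univ_add]
    simp only [Fin.val_castAdd, Fin.is_lt, if_true, Fin.val_natAdd, Nat.not_lt.2 (Nat.le_add_right _ _),
      if_false, Finset.sum_const_zero, add_zero]
    refine Finset.sum_congr rfl fun j _ => ?_
    rw [← generatorMatrix_mulVec, finSumFinEquiv_apply_left]
  simp only [h2]
  rw [Finset.sum_comm (s := Finset.range (N + 1))]
  refine Finset.sum_congr rfl fun j _ => ?_
  refine (Finset.Nat.sum_antidiagonal_swap (n := t)).symm.trans ?_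
  rw [Finset.Nat.sum_antidiagonal_eq_sum_range_succ_mk]
  refine Eq.trans ?_ (Finset.sum_subset (Finset.range_subset_range.2 (Nat.succ_le_of_lt ht)) ?_)
  · refine Finset.sum_congr rfl fun b hb => ?_
    rw [lowerToeplitz_eq_blockSeq s (Nat.lt_succ_iff.1 (Finset.mem_range.1 hb))]
    rfl
  · intro b _ hb
    rw [lowerToeplitz_eq_zero s (by simpa using hb), zero_mul]

/-- The input part Q of the generator is invertible modulo z^(N+1) because Q(0) is, so an impulse
can be prescribed as input up to time N. -/
lemma exists_mulVec_coeff_eq (hk : 0 < k) (hA : IsDenominator d e (blockSeq k r s) A) (N : ℕ) :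
    ∃ m : Fin k → F[X], ∀ j : Fin k, ∀ t ≤ N,
      ((generatorMatrix (r := r) d s A).mulVec m (finSumFinEquiv (Sum.inl j))).coeff t =
        if t = 0 ∧ (j : ℕ) = 0 then 1 else 0 := by
  let Q : Matrix (Fin k) (Fin k) F[X] :=
    Matrix.of fun j' j => generator d (blockSeq k r s) A (Sum.inl j') j
  have hdet : Q.det.coeff 0 ≠ 0 := by
    rw [coeff_zero_eq_eval_zero, ← coe_evalRingHom, RingHom.map_det]
    intro h0
    obtain ⟨α, hα, h⟩ := Matrix.exists_mulVec_eq_zero_iff.2 h0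
    refine hα (eq_zero_of_eval₂_zero_generator hA (RingHom.id F) α fun j' => ?_)
    have := congrFun h j'
    simpa [Matrix.mulVec, dotProduct, Q, eval₂_id, coeff_zero_eq_eval_zero] using this
  have hcop : IsCoprime Q.det (X ^ (N + 1)) :=
    (prime_X.irreducible.coprime_iff_not_dvd.2 fun h => hdet (X_dvd_iff.1 h)).symm.pow_right
  -- The identity a det Q + b z^(N+1) = 1 makes a adj(Q) an inverse of Q modulo z^(N+1).
  obtain ⟨a, b, hab⟩ := hcop
  let u : Fin k → F[X] := Pi.single ⟨0, hk⟩ 1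
  refine ⟨a • Q.adjugate.mulVec u, fun j t ht => ?_⟩
  have h1 : (generatorMatrix (r := r) d s A).mulVec (a • Q.adjugate.mulVec u)
      (finSumFinEquiv (Sum.inl j)) = Q.mulVec (a • Q.adjugate.mulVec u) j := by
    rw [generatorMatrix_mulVec]
    rfl
  have h2 : Q.mulVec (a • Q.adjugate.mulVec u) j = (1 - b * X ^ (N + 1)) * u j := by
    rw [Matrix.mulVec_smul, Matrix.mulVec_mulVec, Matrix.mul_adjugate, Matrix.smul_mulVec,
      Matrix.one_mulVec, Pi.smul_apply, Pi.smul_apply, smul_eq_mul, smul_eq_mul, ← mul_assoc,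
      ← hab, add_sub_cancel_right]
  rw [h1, h2]
  by_cases hj : j = ⟨0, hk⟩
  · have : (j : ℕ) = 0 := by rw [hj]
    rw [hj, show u ⟨0, hk⟩ = 1 from Pi.single_eq_same _ _, mul_one, coeff_sub, coeff_mul_X_pow', if_neg (by omega), sub_zero,
      coeff_one]
    simp
  · have : (j : ℕ) ≠ 0 := fun h => hj (Fin.ext h)
    rw [show u j = 0 from Pi.single_eq_of_ne hj _]
    simp [this]

/-- `lt_card_support` is the lower bound. The impulse input attains it: one nonzero input and at
most r(j+1) nonzero outputs. -/
lemma columnDistance_eq (hk : 0 < k) (hA : IsDenominator d e (blockSeq k r s) A) {N : ℕ}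
    (hN : ∀ i j, N ≤ d j + e i)
    (hreg : ∀ E ∈ columnSets k r (N + 1),
      IsRegular s (missingOutputs k r (N + 1) E) (inputs k r E)) {j : ℕ} (hj : j ≤ N) :
    columnDistance (LinearMap.range (generatorMatrix (r := r) d s A).mulVecLin) j =
      r * (j + 1) + 1 := by
  classical
  have hn : 0 < k + r := by omega
  have hlow : ∀ v ∈ LinearMap.range (generatorMatrix (r := r) d s A).mulVecLin,
      coeffVec v 0 ≠ 0 → r * (j + 1) + 1 ≤ truncWeight v j := by
    rintro _ ⟨m, rfl⟩ hv
    rw [Matrix.mulVecLin_apply] at hv ⊢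
    have hw := flatten_mulVec_eq_sum hn hA hN m
    rw [truncWeight_eq_card hn, mul_comm]
    refine lt_card_support s hreg _ hw ?_ j (by omega)
    -- Zero inputs at time 0 force zero outputs at time 0, since an output depends only on earlier
    -- positions.
    by_contra! hzero
    refine hv (funext fun c => ?_)
    have hc := flatten_mul_add hn ((generatorMatrix d s A).mulVec m) 0 c
    rw [zero_mul, zero_add] at hc
    rw [coeffVec, ← hc]
    by_cases hck : (c : ℕ) < k
    · exact hzero c hck
    · rw [hw c]
      · refine Finset.sum_eq_zero fun y hy => ?_
        rw [inputs, Finset.mem_filter] at hy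
        by_cases hyc : y < c
        · rw [Nat.mod_eq_of_lt (by omega)] at hy
          rw [hzero y hy.2, mul_zero]
        · rw [lowerToeplitz, if_neg hyc, zero_mul]
      · rw [outputs, Finset.mem_filter, Finset.mem_range, Nat.mod_eq_of_lt c.2, Nat.add_mul]
        omega
  obtain ⟨m, hm⟩ := exists_mulVec_coeff_eq (r := r) hk hA j
  have hm0 : coeffVec ((generatorMatrix (r := r) d s A).mulVec m) 0 ≠ 0 := by
    intro h0
    have h1 := congrFun h0 (finSumFinEquiv (Sum.inl ⟨0, hk⟩))
    rw [coeffVec, hm _ 0 (Nat.zero_le _)] at h1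
    simp at h1
  have hmem : (generatorMatrix (r := r) d s A).mulVec m ∈
      LinearMap.range (generatorMatrix (r := r) d s A).mulVecLin := ⟨m, rfl⟩
  have hup : truncWeight ((generatorMatrix (r := r) d s A).mulVec m) j ≤ r * (j + 1) + 1 := by
    rw [truncWeight_eq_card hn, mul_comm r, ← card_outputs (k := k) (r := r) (j + 1)]
    refine le_trans (Finset.card_le_card (t := insert 0 (outputs k r (j + 1))) fun x hx => ?_)
      (Finset.card_insert_le _ _)
    rw [Finset.mem_filter, Finset.mem_range] at hx
    rw [Finset.mem_insert, outputs, Finset.mem_filter, Finset.mem_range]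
    by_contra! hcon
    have hxk := hcon.2 hx.1
    have hxj : x / (k + r) ≤ j := Nat.lt_succ_iff.1 ((Nat.div_lt_iff_lt_mul hn).2 hx.1)
    have h1 := flatten_mul_add hn ((generatorMatrix (r := r) d s A).mulVec m) (x / (k + r))
      (finSumFinEquiv (Sum.inl ⟨x % (k + r), hxk⟩))
    rw [hm _ _ hxj] at h1
    simp only [finSumFinEquiv_apply_left, Fin.val_castAdd, Nat.div_add_mod'] at h1
    rw [if_neg] at h1
    · exact hx.2 h1
    · rintro ⟨h2, h3⟩
      have := Nat.div_add_mod' x (k + r)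
      rw [h2, h3] at this
      exact hcon.1 (by omega)
  refine le_antisymm ?_ ?_
  · exact le_trans (Nat.sInf_le ⟨_, hmem, hm0, rfl⟩) hup
  · refine le_csInf ⟨_, _, hmem, hm0, rfl⟩ ?_
    rintro w ⟨v, hv, hv0, rfl⟩
    exact hlow v hv hv0

lemma sum_add_ite_lt (k a s : ℕ) (h : s ≤ k) :
    ∑ j : Fin k, (a + if (j : ℕ) < s then 1 else 0) = k * a + s := by
  rw [Finset.sum_add_distrib, Finset.sum_const, Finset.card_univ, Fintype.card_fin, smul_eq_mul,
    Fin.sum_univ_eq_sum_range (fun j => if j < s then 1 else 0), ← Finset.sum_filter,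
    Finset.sum_const, smul_eq_mul, mul_one]
  congr 1
  have : (Finset.range k).filter (· < s) = Finset.range s := by
    ext x
    simp only [Finset.mem_filter, Finset.mem_range]
    omega
  rw [this, Finset.card_range]

/-- The set E of all outputs contains no input, so its minor is empty and equals 1. Its slot in the
product is given to the Hankel minor, which thus costs nothing in the field size. -/
lemma exists_isRegular_family (d : Fin k → ℕ) (e : Fin r → ℕ) (a N : ℕ) (hd : ∀ j, d j ≤ a + 1)
    (hde : ∑ j, d j = ∑ i, e i) (hdN : ∑ j, d j ≤ (N + 1) * r)
    (hF : (((columnSets k r (N + 1)).card * ((N + 1) * r) : ℕ) : ℕ∞) < ENat.card F) :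
    ∃ s : ℕ → F, IsRegular s (hankelRows k e a) (hankelCols r d a) ∧
      ∀ E ∈ columnSets k r (N + 1), IsRegular s (missingOutputs k r (N + 1) E) (inputs k r E) := by
  classical
  obtain ⟨s, hs⟩ := exists_isRegular (F := F) (columnSets k r (N + 1))
    (fun E => if inputs k r E = ∅ then hankelRows k e a else missingOutputs k r (N + 1) E)
    (fun E => if inputs k r E = ∅ then hankelCols r d a else inputs k r E) (fun E hE => by
      split_ifs
      · exact dominates_hankel d e a hd hde
      · exact dominates_of_mem_columnSets hE) ((N + 1) * r) (fun E hE => by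
      split_ifs
      · rwa [card_hankelCols d a hd]
      · exact card_inputs_le hE) hF
  refine ⟨s, ?_, fun E hE => ?_⟩
  · simpa only [inputs_outputs, if_true] using hs _ (outputs_mem_columnSets (N + 1))
  · by_cases h : inputs k r E = ∅
    · obtain ⟨hc, -⟩ := dominates_of_mem_columnSets hE
      have : IsEmpty (Fin (inputs k r E).card) := by
        rw [h, Finset.card_empty]
        infer_instance
      exact ⟨hc, by rw [Matrix.det_isEmpty]; exact one_ne_zero⟩
    · simpa only [h, if_false] using hs E hE

end MDP

end ConvCode

end

/-! ### Assembly -/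

theorem mainTheorem1 {F : Type*} [Field F] (n k δ : ℕ) (hk : 1 ≤ k) (hkn : k < n)
    (hF : ((min (ConvCode.M₁ n k δ) (min (ConvCode.M₂ n k δ) (ConvCode.M₃ n k δ)) : ℕ) : ℕ∞) <
      ENat.card F) :
    ∃ C : Submodule (Polynomial F) (Fin n → Polynomial F),
      ConvCode.IsConvolutionalCode k δ C ∧ ConvCode.IsNoncatastrophic k C ∧
        ConvCode.IsMDP k δ C := by
  have hcard := (Nat.cast_le (α := ℕ∞)).2 (ConvCode.card_columnSets_mul_le_min (δ := δ) hkn)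
  replace hF := hcard.trans_lt hF
  obtain ⟨r, rfl⟩ := Nat.exists_eq_add_of_le hkn.le
  have hr : 0 < r := by omega
  rw [Nat.add_sub_cancel_left] at hF
  set N := ConvCode.L (k + r) k δ with hN
  rw [ConvCode.L, Nat.add_sub_cancel_left] at hN
  -- Both degree sequences split δ as evenly as possible, which gives d j + e i ≥ L and column
  -- degrees that differ by at most 1.
  let d : Fin k → ℕ := fun j => δ / k + if (j : ℕ) < δ % k then 1 else 0
  let e : Fin r → ℕ := fun i => δ / r + if (i : ℕ) < δ % r then 1 else 0
  have hdsum : ∑ j, d j = δ := by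
    rw [ConvCode.sum_add_ite_lt _ _ _ (Nat.mod_lt _ hk).le, Nat.div_add_mod]
  have hesum : ∑ i, e i = δ := by
    rw [ConvCode.sum_add_ite_lt _ _ _ (Nat.mod_lt _ hr).le, Nat.div_add_mod]
  have hd : ∀ j, δ / k ≤ d j ∧ d j ≤ δ / k + 1 := fun j => by
    simp only [d]
    split_ifs <;> omega
  have he : ∀ i, δ / r ≤ e i := fun i => Nat.le_add_right _ _
  have hNde : ∀ i j, N ≤ d j + e i := fun i j => by
    have := (hd j).1
    have := he i
    omega
  -- The Hankel minor has size δ and must not exceed the size (L+1)r allowed for the other minors.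
  have hδ : δ ≤ (N + 1) * r := by
    have h1 := Nat.lt_mul_div_succ δ hr
    have h2 : r * (δ / r + 1) ≤ (N + 1) * r := by
      rw [mul_comm]
      exact Nat.mul_le_mul_right _ (by rw [hN]; exact Nat.succ_le_succ (Nat.le_add_left _ _))
    omega
  obtain ⟨s, hH, hreg⟩ := ConvCode.exists_isRegular_family (F := F) d e (δ / k) N
    (fun j => (hd j).2) (by rw [hdsum, hesum]) (by rw [hdsum]; exact hδ) hF
  have hHK := fun (K : Type _) [Field K] (φ : F →+* K) =>
    ConvCode.hankelInjective_of_isRegular φ s d e (δ / k) (fun j => (hd j).2) hH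
  have hHF : ConvCode.HankelInjective d e (ConvCode.blockSeq k r s) := hHK F (RingHom.id F)
  obtain ⟨A, hA⟩ := ConvCode.exists_isDenominator hHF (by rw [hdsum, hesum]) fun j j' => by
    have := (hd j).1
    have := (hd j').2
    omega
  have hminor := ConvCode.minorDegree_eq (ConvCode.generatorMatrix (r := r) d s A) d
    (fun i j => ConvCode.natDegree_generator_le hA _ _) fun α hα =>
      ConvCode.eq_zero_of_leadingCoeff hA hHF α fun x => by
        have := hα (finSumFinEquiv x)
        simpa only [ConvCode.generatorMatrix, Matrix.of_apply, Equiv.symm_apply_apply] using this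
  have hG := ConvCode.isGeneratorMatrix_range _ hminor.1
  refine ⟨_, hG.isConvolutionalCode (hminor.2.trans hdsum), ⟨_, hG, ?_⟩, fun j hj => ?_⟩
  · refine ConvCode.isRightPrime_of_forall _ fun x α hα => ?_
    refine ConvCode.eq_zero_of_eval₂_generator hA _ (hHK _ (algebraMap F (AlgebraicClosure F))) x α fun y => ?_
    have := hα (finSumFinEquiv y)
    simpa only [ConvCode.generatorMatrix, Matrix.of_apply, Equiv.symm_apply_apply] using this
  · rw [Nat.add_sub_cancel_left]
    exact ConvCode.columnDistance_eq hk hA hNde hreg hj
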